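/- Let $\theta\in\mathbb R$, $\lambda=e^{2\pi i\theta}$, $\mu=e^{\pi i\theta}$. Let $\Omega(S^7_{\theta'})$ be the differential graded algebra generated by $\psi_a,\psi_a^*$ (degree $0$) and $d\psi_a,d\psi_a^*$ (degree $1$), $a=1,\dots,4$, with the relations $$\psi_a\psi_b=\lambda'_{ab}\psi_b\psi_a,\quad \psi_a\psi_b^*=\lambda'_{ba}\psi_b^*\psi_a,\quad \psi_a^*\psi_b^*=\lambda'_{ab}\psi_b^*\psi_a^*,\quad \textstyle\sum_a\psi_a^*\psi_a=1,$$ the same commutation relations (with an additional sign between two elements of degree $1$) when some of the generators are replaced by their differentials, and $d\big(\sum_a\psi_a^*\psi_a\big)=0$; here $$\lambda'=\begin{pmatrix}1&1&\bar\mu&\mu\\1&1&\mu&\bar\mu\\ \mu&\bar\mu&1&1\\ \bar\mu&\mu&1&1\end{pmatrix}.$$ Put $z_0=\psi_1^*\psi_1+\psi_2^*\psi_2-\psi_3^*\psi_3-\psi_4^*\psi_4$, $z_1=2(\psi_1\psi_3^*+\psi_2^*\psi_4)$, $z_2=2(-\psi_1^*\psi_4+\psi_2\psi_3^*)$. Let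 $A(S^4_\theta)$ be the subalgebra generated by $z_0,z_1,z_2,z_1^*,z_2^*$, and let $\Omega^k(S^4_\theta)$ be the span of the forms $a_0\,da_1\cdots da_k$ with $a_j\in A(S^4_\theta)$. Let $$\Psi=\begin{pmatrix}\psi_1&-\psi_2^*\\ \psi_2&\psi_1^*\\ \psi_3&-\psi_4^*\\ \psi_4&\psi_3^*\end{pmatrix},\qquad p=\Psi\Psi^*,\qquad \omega=\Psi^*d\Psi,\qquad E=p\,A(S^4_\theta)^4 ,\qquad E\otimes\Omega^k(S^4_\theta)=p\,\Omega^k(S^4_\theta)^4.$$ A $k$-form valued endomorphism of $E$ is a matrix $M\in M_4(\Omega^k(S^4_\theta))$ with $pM=M=Mp$. Let $H_1=\tfrac12\mathrm{diag}(1,-1,-1,1)$, $H_2=\tfrac12\mathrm{diag}(-1,1,-1,1)$, and let $\lambda^{sH_j}$ be the diagonal matrix $e^{2\pi i\theta sH_j}$. Denote the matrix units by $e_{ab}$ and put $\gamma_0=\mathrm{diag}(1,1,-1,-1)$, $\gamma_1=2(e_{24}+\mu e_{31})$, $\gamma_2=2(-e_{14}+\bar\mu e_{32})$, $\gamma_3=\gamma_1^*$,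 $\gamma_4=\gamma_2^*$, $z_3=z_1^*$, $z_4=z_2^*$. Let $T_0,\dots,T_4=H_0,G_{1,0},G_{0,1},G_{-1,0},G_{0,-1}$ be the five conformal generators that extend the twisted rotations $U_\theta(so(5))$ to $U_\theta(so(5,1))$; their weights are $r=(r_1,r_2)=(0,0),(1,0),(0,1),(-1,0),(0,-1)$. On $\Psi$ the generator $T_i$ acts by left multiplication with $$\Gamma_i=\tfrac12\big(-z_i\lambda^{-r_1H_2}+\lambda^{-r_2H_1}\gamma_i\big),$$ and on $\Psi^*$ by $\Psi^*_{ka}\mapsto\sum_b(\sigma\Gamma_i\sigma^{-1})_{ab}\Psi^*_{kb}$, where $\sigma=e_{21}-e_{12}+e_{43}-e_{34}$. It commutes with $d$ and acts on products by the twisted Leibniz rule of the coproduct $\Delta(T_i)=T_i\otimes\lambda^{-r_1H_2}+\lambda^{-r_2H_1}\otimes T_i$, where $\lambda^{sH_j}$ acts on $\Psi$ as $\Psi\mapsto\lambda^{sH_j}\Psi$ and on $\Psi^*$ as $\Psi^*\mapsto\Psi^*\lambda^{-sH_j}$. Let $$\delta\omega_i=T_i(\omega)=T_i(\Psi^*)\,\lambda^{-r_1H_2}d\Psi+\Psi^*\lambda^{r_2H_1}\,d\big(T_i(\Psi)\big).$$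 For $t\in\mathbb R$ let $\nabla_{t,i}=\nabla_0+t\,\delta\omega_i+O(t^2)$ be the operator $\varphi\mapsto d\varphi+(\omega+t\,\delta\omega_i)\varphi$ on equivariant maps $\varphi$, carried to $E$ and to $E$-valued forms by $\eta\mapsto\Psi^*\eta$ (with inverse $\varphi\mapsto\Psi\varphi$), plus an arbitrary $O(t^2)$ family of $1$-form valued endomorphisms of $E$. Here an $O(t^2)$ family is a finite sum $\sum_jc_j(t)M_j$ with fixed $k$-form valued endomorphisms $M_j$ of $E$ and scalar functions $c_j(t)=O(t^2)$ as $t\to0$. Then $\nabla_{t,i}$ is a connection on the right module $E$ for all $t$. Its curvature $F_{t,i}=\nabla_{t,i}^2$ is given, on $E\otimes\Omega^k(S^4_\theta)$ for every $k$, by left multiplication with $$F_{t,i}=F_0+t\,\delta F_i+O(t^2),\qquad F_0=p\,dp\,dp,$$ where $F_0$, $\delta F_i$ and the $O(t^2)$ family are $2$-form valued endomorphisms of $E$ and $$\delta F_0=-2z_0F_0,\quad \delta F_1=-2z_1\lambda^{-H_2}F_0,\quad \delta F_2=-2z_2\lambda^{H_1}F_0,\quad \delta F_3=-2z_1^*\lambda^{H_2}F_0,\quad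 \delta F_4=-2z_2^*\lambda^{-H_1}F_0 .$$ -/

import Mathlib

open scoped Matrix Topology

noncomputable section

namespace ToricInstanton

/-- The deformation parameter `μ = √λ = e^{π i θ}`, where `λ = e^{2 π i θ}`. -/
def mu (θ : ℝ) : ℂ := Complex.exp (2 * Real.pi * Complex.I * (θ / 2 : ℝ))

/-- The real antisymmetric matrix `θ'` that is attached to the noncommutative 7-sphere. -/
def thetaPrime (θ : ℝ) : Matrix (Fin 4) (Fin 4) ℝ :=
  (θ / 2) • !![0, 0, -1, 1; 0, 0, 1, -1; 1, -1, 0, 0; -1, 1, 0, 0]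

/-- `λ'_{ab} = e^{2 π i θ'_{ab}}`. -/
def lamPrime (θ : ℝ) (a b : Fin 4) : ℂ :=
  Complex.exp (2 * Real.pi * Complex.I * (thetaPrime θ a b : ℝ))

/-- The generators of the calculus on the 7-sphere: `ψ_a`, `ψ_a^*` (`form = false`) and
`dψ_a`, `dψ_a^*` (`form = true`); the field `conj` tells the starred generators. -/
structure Gen where
  idx : Fin 4
  conj : Bool
  form : Bool

/-- The factor `c` in the relation `x y = c y x` between two generators. -/
def coef (θ : ℝ) (x y : Gen) : ℂ :=
  (if x.form && y.form then -1 else 1) *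
    (if x.conj = y.conj then lamPrime θ x.idx y.idx else lamPrime θ y.idx x.idx)

/-- The relations of the differential calculus: the deformed (graded) commutation relations, the
spherical relation `∑ ψ_a^* ψ_a = 1` and its differential. -/
inductive Rel (θ : ℝ) : FreeAlgebra ℂ Gen → FreeAlgebra ℂ Gen → Prop
  | comm (x y : Gen) :
      Rel θ (FreeAlgebra.ι ℂ x * FreeAlgebra.ι ℂ y)
        (coef θ x y • (FreeAlgebra.ι ℂ y * FreeAlgebra.ι ℂ x))
  | sphere :
      Rel θ (∑ a, FreeAlgebra.ι ℂ (Gen.mk a true false) * FreeAlgebra.ι ℂ (Gen.mk a false false)) 1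
  | dsphere :
      Rel θ (∑ a,
        (FreeAlgebra.ι ℂ (Gen.mk a true true) * FreeAlgebra.ι ℂ (Gen.mk a false false) +
          FreeAlgebra.ι ℂ (Gen.mk a true false) * FreeAlgebra.ι ℂ (Gen.mk a false true))) 0

/-- The algebra `Ω(S^7_{θ'})` of polynomial differential forms on the noncommutative 7-sphere. -/
def Omega7 (θ : ℝ) : Type := RingQuot (Rel θ)

instance (θ : ℝ) : Ring (Omega7 θ) := inferInstanceAs (Ring (RingQuot (Rel θ)))

instance (θ : ℝ) : Algebra ℂ (Omega7 θ) := inferInstanceAs (Algebra ℂ (RingQuot (Rel θ)))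

/-- The quotient map from the free algebra. -/
def toOmega7 (θ : ℝ) : FreeAlgebra ℂ Gen →ₐ[ℂ] Omega7 θ := RingQuot.mkAlgHom ℂ (Rel θ)

theorem toOmega7_rel (θ : ℝ) {x y : FreeAlgebra ℂ Gen} (h : Rel θ x y) :
    toOmega7 θ x = toOmega7 θ y :=
  RingQuot.mkAlgHom_rel ℂ h

/-- The image of a generator in `Ω(S^7_{θ'})`. -/
def gen (θ : ℝ) (x : Gen) : Omega7 θ := toOmega7 θ (FreeAlgebra.ι ℂ x)

theorem gen_comm (θ : ℝ) (x y : Gen) :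
    gen θ x * gen θ y = coef θ x y • (gen θ y * gen θ x) := by
  have h := toOmega7_rel θ (Rel.comm (θ := θ) x y)
  simpa only [gen, map_mul, map_smul] using h

theorem gen_sphere (θ : ℝ) :
    ∑ a, gen θ (Gen.mk a true false) * gen θ (Gen.mk a false false) = 1 := by
  have h := toOmega7_rel θ (Rel.sphere (θ := θ))
  simpa only [gen, map_mul, map_sum, map_one] using h

theorem gen_dsphere (θ : ℝ) :
    ∑ a, (gen θ (Gen.mk a true true) * gen θ (Gen.mk a false false) +
      gen θ (Gen.mk a true false) * gen θ (Gen.mk a false true)) = 0 := by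
  have h := toOmega7_rel θ (Rel.dsphere (θ := θ))
  simpa only [gen, map_mul, map_add, map_sum, map_zero] using h

/-- The values on generators of the homomorphism `w ↦ (s(w), dw; 0, w)`, where `s` is the grading
automorphism `s(w) = (-1)^{|w|} w`. -/
def diffMatrix (θ : ℝ) (x : Gen) : Matrix (Fin 2) (Fin 2) (Omega7 θ) :=
  !![(if x.form then -gen θ x else gen θ x),
      (if x.form then 0 else gen θ (Gen.mk x.idx x.conj true)); 0, gen θ x]

theorem diffMatrix_rel (θ : ℝ) ⦃x y : FreeAlgebra ℂ Gen⦄ (h : Rel θ x y) :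
    FreeAlgebra.lift ℂ (diffMatrix θ) x = FreeAlgebra.lift ℂ (diffMatrix θ) y := by
  have hc : ∀ u v : Gen, gen θ u * gen θ v = coef θ u v • (gen θ v * gen θ u) := gen_comm θ
  induction h with
  | comm x y =>
    obtain ⟨a, s, f⟩ := x
    obtain ⟨b, t, g⟩ := y
    have h00 := hc ⟨a, s, f⟩ ⟨b, t, g⟩
    have h01 := hc ⟨a, s, f⟩ ⟨b, t, true⟩
    have h10 := hc ⟨a, s, true⟩ ⟨b, t, g⟩
    simp only [map_mul, map_smul, FreeAlgebra.lift_ι_apply, diffMatrix]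
    ext i j
    cases f <;> cases g <;> fin_cases i <;> fin_cases j <;>
      simp [Matrix.mul_apply, coef] at h00 h01 h10 ⊢ <;>
      first
        | assumption
        | (split_ifs at h00 h01 h10 ⊢ <;>
            first
              | (rw [h01, h10]; abel)
              | simp [h00]
              | simp [h01]
              | exact h10)
  | sphere =>
    have h0 := gen_sphere θ
    have h1 := gen_dsphere θ
    simp only [Fin.sum_univ_four] at h0 h1
    simp only [map_sum, map_mul, map_one, FreeAlgebra.lift_ι_apply, diffMatrix]
    ext i j
    fin_cases i <;> fin_cases j <;>
      simp [Fin.sum_univ_four] <;>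
      first
        | exact h0
        | (rw [← h1]; abel)
  | dsphere =>
    have h1 := gen_dsphere θ
    simp only [Fin.sum_univ_four] at h1
    simp only [map_sum, map_mul, map_add, map_zero, FreeAlgebra.lift_ι_apply, diffMatrix]
    ext i j
    fin_cases i <;> fin_cases j <;>
      simp [Fin.sum_univ_four] <;>
      first
        | exact h1
        | (rw [← neg_eq_zero, ← h1]; abel)

/-- The algebra homomorphism `w ↦ (s(w), dw; 0, w)` on `Ω(S^7_{θ'})`. Its multiplicativity is
the graded Leibniz rule `d(v w) = (dv) w + (-1)^{|v|} v (dw)`. -/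
def diffHom (θ : ℝ) : Omega7 θ →ₐ[ℂ] Matrix (Fin 2) (Fin 2) (Omega7 θ) :=
  RingQuot.liftAlgHom ℂ ⟨FreeAlgebra.lift ℂ (diffMatrix θ), diffMatrix_rel θ⟩

/-- The exterior differential `d` of `Ω(S^7_{θ'})`: the graded derivation with `d(x) = dx` and
`d(dx) = 0` on generators. -/
def d (θ : ℝ) : Omega7 θ →ₗ[ℂ] Omega7 θ where
  toFun w := diffHom θ w 0 1
  map_add' v w := by simp
  map_smul' c w := by simp

/-- The coordinate `ψ_{a+1}`. -/
def psi (θ : ℝ) (a : Fin 4) : Omega7 θ := gen θ (Gen.mk a false false)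

/-- The coordinate `ψ_{a+1}^*`. -/
def psiStar (θ : ℝ) (a : Fin 4) : Omega7 θ := gen θ (Gen.mk a true false)

/-- The elements `z_0, z_1, z_2, z_1^*, z_2^*`, in this order. -/
def z (θ : ℝ) : Fin 5 → Omega7 θ :=
  ![psiStar θ 0 * psi θ 0 + psiStar θ 1 * psi θ 1 - psiStar θ 2 * psi θ 2 - psiStar θ 3 * psi θ 3,
    2 * (psi θ 0 * psiStar θ 2 + psiStar θ 1 * psi θ 3),
    2 * (-(psiStar θ 0 * psi θ 3) + psi θ 1 * psiStar θ 2),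
    2 * (psi θ 2 * psiStar θ 0 + psiStar θ 3 * psi θ 1),
    2 * (-(psiStar θ 3 * psi θ 0) + psi θ 2 * psiStar θ 1)]

/-- The coordinate algebra `A(S^4_θ)`, generated by the `z`'s. -/
def A4 (θ : ℝ) : Subalgebra ℂ (Omega7 θ) := Algebra.adjoin ℂ (Set.range (z θ))

/-- The space `Ω^k(S^4_θ)` of `k`-forms on the noncommutative 4-sphere, spanned by the products
`a_0 da_1 ⋯ da_k` with `a_j` in `A(S^4_θ)`. -/
def Omega4 (θ : ℝ) : ℕ → Submodule ℂ (Omega7 θ)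
  | 0 => Subalgebra.toSubmodule (A4 θ)
  | k + 1 => Omega4 θ k * (Subalgebra.toSubmodule (A4 θ)).map (d θ)

/-- A complex matrix seen as a matrix of forms. -/
def const (θ : ℝ) {m n : Type} (M : Matrix m n ℂ) : Matrix m n (Omega7 θ) :=
  M.map (algebraMap ℂ (Omega7 θ))

/-- The `4 × 2` matrix `Ψ`. -/
def Psi (θ : ℝ) : Matrix (Fin 4) (Fin 2) (Omega7 θ) :=
  !![psi θ 0, -psiStar θ 1; psi θ 1, psiStar θ 0; psi θ 2, -psiStar θ 3; psi θ 3, psiStar θ 2]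

/-- The `2 × 4` matrix `Ψ^*`. -/
def PsiStar (θ : ℝ) : Matrix (Fin 2) (Fin 4) (Omega7 θ) :=
  !![psiStar θ 0, psiStar θ 1, psiStar θ 2, psiStar θ 3; -psi θ 1, psi θ 0, -psi θ 3, psi θ 2]

/-- The instanton projection `p = Ψ Ψ^*`. -/
def p (θ : ℝ) : Matrix (Fin 4) (Fin 4) (Omega7 θ) := Psi θ * PsiStar θ

/-- The basic instanton gauge potential `ω = Ψ^* dΨ`. -/
def omega (θ : ℝ) : Matrix (Fin 2) (Fin 2) (Omega7 θ) := PsiStar θ * (Psi θ).map (d θ)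

/-- The diagonal of the Cartan generator `H_1` in the spinor representation. -/
def H1 : Fin 4 → ℝ := ![1 / 2, -1 / 2, -1 / 2, 1 / 2]

/-- The diagonal of the Cartan generator `H_2` in the spinor representation. -/
def H2 : Fin 4 → ℝ := ![-1 / 2, 1 / 2, -1 / 2, 1 / 2]

/-- The matrix `λ^H = e^{2 π i θ H}` for a real diagonal matrix `H`. -/
def lamPow (θ : ℝ) (H : Fin 4 → ℝ) : Matrix (Fin 4) (Fin 4) ℂ :=
  Matrix.diagonal fun a => Complex.exp (2 * Real.pi * Complex.I * (θ * H a : ℝ))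

/-- The twisted Dirac matrix `γ_0`. -/
def gamma0 : Matrix (Fin 4) (Fin 4) ℂ := !![1, 0, 0, 0; 0, 1, 0, 0; 0, 0, -1, 0; 0, 0, 0, -1]

/-- The twisted Dirac matrix `γ_1`. -/
def gamma1 (θ : ℝ) : Matrix (Fin 4) (Fin 4) ℂ :=
  (2 : ℂ) • !![0, 0, 0, 0; 0, 0, 0, 1; mu θ, 0, 0, 0; 0, 0, 0, 0]

/-- The twisted Dirac matrix `γ_2`. -/
def gamma2 (θ : ℝ) : Matrix (Fin 4) (Fin 4) ℂ :=
  (2 : ℂ) • !![0, 0, 0, -1; 0, 0, 0, 0; 0, star (mu θ), 0, 0; 0, 0, 0, 0]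

/-- The matrices `γ_0, γ_1, γ_2, γ_1^*, γ_2^*`, in this order. -/
def gamma (θ : ℝ) : Fin 5 → Matrix (Fin 4) (Fin 4) ℂ :=
  ![gamma0, gamma1 θ, gamma2 θ, (gamma1 θ)ᴴ, (gamma2 θ)ᴴ]

/-- The components `r_1` of the weights of the five conformal generators
`H_0, G_{1,0}, G_{0,1}, G_{-1,0}, G_{0,-1}`, in this order. -/
def r1 : Fin 5 → ℝ := ![0, 1, 0, -1, 0]

/-- The components `r_2` of the weights, in the same order. -/
def r2 : Fin 5 → ℝ := ![0, 0, 1, 0, -1]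

/-- The matrices `Γ` by which the five conformal generators act on `ψ` (and on the columns of `Ψ`):
`H_0 = (-z_0 + γ_0)/2`, `G_{1,0} = (-z_1 λ^{-H_2} + γ_1)/2`, `G_{0,1} = (-z_2 + λ^{-H_1} γ_2)/2`
and `G_{-r} = (G_r)^*`. -/
def Gam (θ : ℝ) (i : Fin 5) : Matrix (Fin 4) (Fin 4) (Omega7 θ) :=
  (1 / 2 : ℂ) • (-(z θ i • const θ (lamPow θ (-(r1 i) • H2))) +
    const θ (lamPow θ (-(r2 i) • H1) * gamma θ i))

/-- The matrix `σ`. -/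
def sigma : Matrix (Fin 4) (Fin 4) ℂ := !![0, -1, 0, 0; 1, 0, 0, 0; 0, 0, 0, -1; 0, 0, 1, 0]

/-- `Γ~ = σ Γ σ⁻¹` (the matrix `σ` is orthogonal), by which the generators act on `ψ^*` and on the
rows of `Ψ^*`. -/
def GamTilde (θ : ℝ) (i : Fin 5) : Matrix (Fin 4) (Fin 4) (Omega7 θ) :=
  const θ sigma * Gam θ i * const θ sigmaᵀ

/-- `T_i(Ψ) = Γ Ψ`. -/
def actPsi (θ : ℝ) (i : Fin 5) : Matrix (Fin 4) (Fin 2) (Omega7 θ) := Gam θ i * Psi θ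

/-- `T_i(Ψ^*)_{ka} = ∑_b Γ~_{ab} Ψ^*_{kb}`. -/
def actPsiStar (θ : ℝ) (i : Fin 5) : Matrix (Fin 2) (Fin 4) (Omega7 θ) :=
  Matrix.of fun k a => ∑ b, GamTilde θ i a b * PsiStar θ k b

/-- The variation `δω_i = T_i(ω)` of the gauge potential `ω = Ψ^* dΨ` under the twisted action of the
conformal generator `T_i`. It is computed with the twisted Leibniz rule that belongs to the coproduct
`Δ(T) = T ⊗ λ^{-r_1 H_2} + λ^{-r_2 H_1} ⊗ T` and with `T d = d T`; here `λ^{-r_1 H_2}` acts on `Ψ` by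
that matrix, and `λ^{-r_2 H_1}` acts on `Ψ^*` by the matrix `λ^{r_2 H_1}`. -/
def deltaOmega (θ : ℝ) (i : Fin 5) : Matrix (Fin 2) (Fin 2) (Omega7 θ) :=
  actPsiStar θ i * (const θ (lamPow θ (-(r1 i) • H2)) * (Psi θ).map (d θ)) +
    (PsiStar θ * const θ (lamPow θ (r2 i • H1))) * (actPsi θ i).map (d θ)

/-- `E ⊗ Ω^k(S^4_θ)` for the right module `E = p A(S^4_θ)^4`, realized as `p Ω^k(S^4_θ)^4`; the case
`k = 0` is `E` itself. -/
def EForms (θ : ℝ) (k : ℕ) : Set (Fin 4 → Omega7 θ) :=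
  {η | (∀ a, η a ∈ Omega4 θ k) ∧ p θ *ᵥ η = η}

/-- The endomorphisms of `E` with values in `k`-forms: the matrices `M` in `M_4(Ω^k(S^4_θ))` with
`p M = M = M p`. -/
def EndForms (θ : ℝ) (k : ℕ) : Set (Matrix (Fin 4) (Fin 4) (Omega7 θ)) :=
  {M | (∀ a b, M a b ∈ Omega4 θ k) ∧ p θ * M = M ∧ M * p θ = M}

/-- Connections on the right module `E`, extended to `E`-valued forms. -/
structure IsConnection (θ : ℝ) (nab : (Fin 4 → Omega7 θ) → (Fin 4 → Omega7 θ)) : Prop where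
  maps : ∀ k, ∀ η ∈ EForms θ k, nab η ∈ EForms θ (k + 1)
  add : ∀ k, ∀ η ∈ EForms θ k, ∀ ξ ∈ EForms θ k, nab (η + ξ) = nab η + nab ξ
  smul : ∀ k, ∀ η ∈ EForms θ k, ∀ c : ℂ, nab (c • η) = c • nab η
  leibniz : ∀ k l, ∀ η ∈ EForms θ k, ∀ ρ ∈ Omega4 θ l,
    nab (fun a => η a * ρ) = fun a => nab η a * ρ + (-1) ^ k * (η a * d θ ρ)

/-- `R(t) = O(t^2)` as `t → 0`, for a function of the real variable `t` with values in the `k`-form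
valued endomorphisms of `E`: a finite sum of fixed endomorphisms with scalar coefficients of
order `O(t^2)`. -/
def IsOSq (θ : ℝ) (k : ℕ) (R : ℝ → Matrix (Fin 4) (Fin 4) (Omega7 θ)) : Prop :=
  ∃ (N : ℕ) (c : Fin N → ℝ → ℂ) (M : Fin N → Matrix (Fin 4) (Fin 4) (Omega7 θ)),
    (∀ j, c j =O[𝓝 0] fun t : ℝ => t ^ 2) ∧ (∀ j, M j ∈ EndForms θ k) ∧
      ∀ t, R t = ∑ j, c j t • M j

/-- The operator `φ ↦ dφ + (ω + t δω_i) φ` on (form valued) equivariant maps `φ` from the 7-sphere to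
`ℂ²`. -/
def connEquiv (θ : ℝ) (i : Fin 5) (t : ℝ) (φ : Fin 2 → Omega7 θ) : Fin 2 → Omega7 θ :=
  (fun k => d θ (φ k)) + (omega θ + (t : ℂ) • deltaOmega θ i) *ᵥ φ

/-- The connection `∇_{t,i} = ∇_0 + t δω_i + B(t)`, carried to `E = p A(S^4_θ)^4` by the isomorphism
`σ ↦ Ψ^* σ`, with inverse `φ ↦ Ψ φ`, between `E` and the equivariant maps. -/
def conn (θ : ℝ) (i : Fin 5) (B : ℝ → Matrix (Fin 4) (Fin 4) (Omega7 θ)) (t : ℝ)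
    (η : Fin 4 → Omega7 θ) : Fin 4 → Omega7 θ :=
  Psi θ *ᵥ connEquiv θ i t (PsiStar θ *ᵥ η) + B t *ᵥ η

/-- `F_0 = p dp dp`. -/
def F0 (θ : ℝ) : Matrix (Fin 4) (Fin 4) (Omega7 θ) :=
  p θ * (p θ).map (d θ) * (p θ).map (d θ)

/-- The first order variations of the curvature. -/
def deltaF (θ : ℝ) : Fin 5 → Matrix (Fin 4) (Fin 4) (Omega7 θ) :=
  ![(-2 : ℂ) • (z θ 0 • F0 θ),
    (-2 : ℂ) • (z θ 1 • (const θ (lamPow θ (-H2)) * F0 θ)),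
    (-2 : ℂ) • (z θ 2 • (const θ (lamPow θ H1) * F0 θ)),
    (-2 : ℂ) • (z θ 3 • (const θ (lamPow θ H2) * F0 θ)),
    (-2 : ℂ) • (z θ 4 • (const θ (lamPow θ (-H1)) * F0 θ))]

end ToricInstanton

end

noncomputable section

namespace ToricInstanton

/-! On `E` the connection reads η ↦ p dη + βη with β = tα + B(t) and α = Ψ δω Ψ^* (`conn_eq`,
`Psi_deltaOmega_PsiStar`). Its square is left multiplication by F_0 + p dβ p + β² (`conn_conn_eq`).
Since β² and the contribution of B are O(t²), everything reduces to p dα p = δF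
(`p_mul_dMat_alpha_mul_p`).

Moving z_i or dz_i past Ψ costs exactly the phases λ^{-r_1 H_2 + r_2 H_1} that the twisted coproduct
supplies. Hence u = z_i λ^{-r_1 H_2 + r_2 H_1} and w = dz_i λ^{-r_1 H_2 + r_2 H_1} commute with p
(`p_mul_twistMat`), and α = pγ_i dp p − ½ w p.

The deformed Clifford relation pγ_i + γ_i p = γ_i + u (`p_gamma`) says that γ_i compresses to u on
the range of p and to −u on the complement. The matrix dp exchanges these two ranges, so each of the
two terms in d(pγ_i dp p) contributes −uF_0, while the w term dies because p dp p = 0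
(`variation_identity`). -/

/-! ### The graded differential algebra of the 7-sphere. -/

theorem Omega7.induction {θ : ℝ} {C : Omega7 θ → Prop}
    (algebraMap : ∀ r : ℂ, C (algebraMap ℂ (Omega7 θ) r)) (gen : ∀ x, C (gen θ x))
    (mul : ∀ a b, C a → C b → C (a * b)) (add : ∀ a b, C a → C b → C (a + b))
    (w : Omega7 θ) : C w := by
  obtain ⟨v, rfl⟩ : ∃ v, toOmega7 θ v = w := RingQuot.mkAlgHom_surjective ℂ (Rel θ) w
  induction v using FreeAlgebra.induction with
  | grade0 r => rw [AlgHom.commutes]; exact algebraMap r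
  | grade1 x => exact gen x
  | mul a b ha hb => rw [map_mul]; exact mul _ _ ha hb
  | add a b ha hb => rw [map_add]; exact add _ _ ha hb

theorem diffHom_gen (θ : ℝ) (x : Gen) : diffHom θ (gen θ x) = diffMatrix θ x := by
  have h : diffHom θ (toOmega7 θ (FreeAlgebra.ι ℂ x)) =
      FreeAlgebra.lift ℂ (diffMatrix θ) (FreeAlgebra.ι ℂ x) :=
    RingQuot.liftAlgHom_mkAlgHom_apply ℂ _ (diffMatrix_rel θ) _
  rwa [FreeAlgebra.lift_ι_apply] at h

/-- Upper triangularity with w in the corner turns multiplicativity of `diffHom` into the graded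
Leibniz rule, read off from the entry (0, 1). -/
theorem diffHom_lower (θ : ℝ) (w : Omega7 θ) :
    diffHom θ w 1 0 = 0 ∧ diffHom θ w 1 1 = w := by
  induction w using Omega7.induction with
  | algebraMap r => simp [Matrix.algebraMap_matrix_apply]
  | gen x => simp [diffHom_gen, diffMatrix]
  | mul a b ha hb => simp [Matrix.mul_apply, ha, hb]
  | add a b ha hb => simp [ha, hb]

/-- The grading automorphism `w ↦ (-1)^{|w|} w`. -/
def parity (θ : ℝ) (w : Omega7 θ) : Omega7 θ := diffHom θ w 0 0

theorem parity_mul (θ : ℝ) (v w : Omega7 θ) : parity θ (v * w) = parity θ v * parity θ w := by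
  simp [parity, Matrix.mul_apply, diffHom_lower]

theorem parity_add (θ : ℝ) (v w : Omega7 θ) : parity θ (v + w) = parity θ v + parity θ w := by
  simp [parity]

theorem parity_algebraMap (θ : ℝ) (r : ℂ) :
    parity θ (algebraMap ℂ (Omega7 θ) r) = algebraMap ℂ (Omega7 θ) r := by
  simp [parity, Matrix.algebraMap_matrix_apply]

theorem parity_gen (θ : ℝ) (x : Gen) :
    parity θ (gen θ x) = if x.form then -gen θ x else gen θ x := by
  simp [parity, diffHom_gen, diffMatrix]

theorem d_mul (θ : ℝ) (v w : Omega7 θ) : d θ (v * w) = d θ v * w + parity θ v * d θ w := by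
  simp [d, parity, Matrix.mul_apply, diffHom_lower, add_comm]

theorem d_algebraMap (θ : ℝ) (r : ℂ) : d θ (algebraMap ℂ (Omega7 θ) r) = 0 := by
  simp [d, Matrix.algebraMap_matrix_apply]

theorem d_one (θ : ℝ) : d θ (1 : Omega7 θ) = 0 := by
  simpa using d_algebraMap θ 1

theorem d_gen (θ : ℝ) (x : Gen) :
    d θ (gen θ x) = if x.form then 0 else gen θ ⟨x.idx, x.conj, true⟩ := by
  simp [d, diffHom_gen, diffMatrix]

theorem parity_neg (θ : ℝ) (v : Omega7 θ) : parity θ (-v) = -parity θ v := by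
  simp [parity]

theorem parity_parity (θ : ℝ) (w : Omega7 θ) : parity θ (parity θ w) = w := by
  induction w using Omega7.induction with
  | algebraMap r => simp [parity_algebraMap]
  | gen x =>
    obtain ⟨a, c, f⟩ := x
    cases f <;> simp [parity_gen, parity_neg]
  | mul a b ha hb => rw [parity_mul, parity_mul, ha, hb]
  | add a b ha hb => rw [parity_add, parity_add, ha, hb]

theorem parity_d (θ : ℝ) (w : Omega7 θ) : parity θ (d θ w) = -d θ (parity θ w) := by
  induction w using Omega7.induction with
  | algebraMap r =>
    rw [parity_algebraMap, d_algebraMap, neg_zero]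
    simp [parity]
  | gen x =>
    obtain ⟨a, c, f⟩ := x
    cases f
    · simp [parity_gen, d_gen]
    · simp only [d_gen, parity_gen, if_true, map_neg, neg_zero]
      simp [parity]
  | mul a b ha hb =>
    simp only [d_mul, parity_mul, parity_add, parity_parity, ha, hb, neg_add, neg_mul, mul_neg]
  | add a b ha hb => simp [map_add, parity_add, ha, hb, add_comm]

/-- On a product the two mixed terms cancel because `d` anticommutes with `parity`. -/
theorem d_d (θ : ℝ) (w : Omega7 θ) : d θ (d θ w) = 0 := by
  induction w using Omega7.induction with
  | algebraMap r => simp [d_algebraMap]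
  | gen x =>
    obtain ⟨a, c, f⟩ := x
    cases f <;> simp [d_gen]
  | mul a b ha hb => simp [d_mul, map_add, ha, hb, parity_d, parity_parity]
  | add a b ha hb => simp [ha, hb]

/-- `w` has parity `(-1)^k`. -/
def HasParity (θ : ℝ) (k : ℕ) (w : Omega7 θ) : Prop := parity θ w = (-1) ^ k * w

theorem HasParity.d_mul {θ : ℝ} {k : ℕ} {v : Omega7 θ} (h : HasParity θ k v) (w : Omega7 θ) :
    d θ (v * w) = d θ v * w + (-1) ^ k * (v * d θ w) := by
  rw [ToricInstanton.d_mul, h, mul_assoc]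

theorem HasParity.add {θ : ℝ} {k : ℕ} {v w : Omega7 θ} (hv : HasParity θ k v)
    (hw : HasParity θ k w) : HasParity θ k (v + w) := by
  simp only [HasParity] at *
  rw [parity_add, hv, hw, mul_add]

theorem HasParity.mul {θ : ℝ} {k l : ℕ} {v w : Omega7 θ} (hv : HasParity θ k v)
    (hw : HasParity θ l w) : HasParity θ (k + l) (v * w) := by
  simp only [HasParity] at *
  rw [parity_mul, hv, hw, pow_add, mul_assoc, mul_assoc, ← mul_assoc v,
    ← ((Commute.neg_one_left v).pow_left l).eq, mul_assoc]

theorem HasParity.d {θ : ℝ} {k : ℕ} {w : Omega7 θ} (h : HasParity θ k w) :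
    HasParity θ (k + 1) (d θ w) := by
  simp only [HasParity] at *
  rw [parity_d, h]
  rcases neg_one_pow_eq_or (Omega7 θ) k with hk | hk <;> simp [pow_succ, hk]

theorem HasParity.algebraMap (θ : ℝ) (r : ℂ) : HasParity θ 0 (algebraMap ℂ (Omega7 θ) r) := by
  simp [HasParity, parity_algebraMap]

theorem HasParity.smul {θ : ℝ} {k : ℕ} {w : Omega7 θ} (c : ℂ) (h : HasParity θ k w) :
    HasParity θ k (c • w) := by
  rw [Algebra.smul_def]
  simpa using (HasParity.algebraMap θ c).mul h

theorem HasParity.sum {θ : ℝ} {k : ℕ} {ι : Type*} {s : Finset ι} {f : ι → Omega7 θ}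
    (h : ∀ i ∈ s, HasParity θ k (f i)) : HasParity θ k (∑ i ∈ s, f i) := by
  induction s using Finset.cons_induction with
  | empty => simp [HasParity, parity]
  | cons a s ha ih =>
    rw [Finset.sum_cons]
    exact (h a (Finset.mem_cons_self a s)).add (ih fun i hi => h i (Finset.mem_cons_of_mem hi))

/-! ### Forms on the 4-sphere. -/

theorem hasParity_z (θ : ℝ) (i : Fin 5) : HasParity θ 0 (z θ i) := by
  have h2 : parity θ 2 = 2 := by
    simpa only [map_ofNat] using parity_algebraMap θ 2
  fin_cases i <;>
    simp [HasParity, z, psi, psiStar, sub_eq_add_neg, parity_add, parity_mul, parity_neg, parity_gen, h2]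

theorem hasParity_A4 {θ : ℝ} {w : Omega7 θ} (h : w ∈ A4 θ) : HasParity θ 0 w := by
  induction h using Algebra.adjoin_induction with
  | mem x hx => obtain ⟨i, rfl⟩ := hx; exact hasParity_z θ i
  | algebraMap r => exact HasParity.algebraMap θ r
  | add x y _ _ hx hy => exact hx.add hy
  | mul x y _ _ hx hy => exact hx.mul hy

theorem hasParity_Omega4 {θ : ℝ} {k : ℕ} {w : Omega7 θ} (h : w ∈ Omega4 θ k) :
    HasParity θ k w := by
  induction k generalizing w with
  | zero => exact hasParity_A4 h
  | succ k ih =>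
    induction h using Submodule.mul_induction_on' with
    | mem_mul_mem v hv x hx =>
      obtain ⟨a, ha, rfl⟩ := hx
      exact (ih hv).mul (hasParity_A4 ha).d
    | add x _ y _ hx hy => exact hx.add hy

/-- In `Omega4` the functions stand on the left; db · a = d(ba) − b da moves a function leftwards
past a differential. -/
theorem Omega4_mul_A4 {θ : ℝ} {k : ℕ} {v a : Omega7 θ} (hv : v ∈ Omega4 θ k) (ha : a ∈ A4 θ) :
    v * a ∈ Omega4 θ k := by
  induction k generalizing v a with
  | zero => exact mul_mem (S := Subalgebra ℂ (Omega7 θ)) hv ha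
  | succ k ih =>
    induction hv using Submodule.mul_induction_on' with
    | mem_mul_mem u hu x hx =>
      obtain ⟨b, hb, rfl⟩ := hx
      have h : d θ b * a = d θ (b * a) - b * d θ a := by
        rw [(hasParity_A4 hb).d_mul]; simp
      rw [mul_assoc, h, mul_sub, ← mul_assoc]
      exact sub_mem (Submodule.mul_mem_mul hu ⟨_, mul_mem (S := Subalgebra ℂ (Omega7 θ)) hb ha, rfl⟩)
        (Submodule.mul_mem_mul (ih hu hb) ⟨a, ha, rfl⟩)
    | add x _ y _ hx hy => rw [add_mul]; exact add_mem hx hy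

theorem Omega4_mul {θ : ℝ} {k l : ℕ} {v w : Omega7 θ} (hv : v ∈ Omega4 θ k)
    (hw : w ∈ Omega4 θ l) : v * w ∈ Omega4 θ (k + l) := by
  induction l generalizing w with
  | zero => exact Omega4_mul_A4 hv hw
  | succ l ih =>
    induction hw using Submodule.mul_induction_on' with
    | mem_mul_mem u hu x hx =>
      rw [← mul_assoc]
      exact Submodule.mul_mem_mul (ih hu) hx
    | add x _ y _ hx hy => rw [mul_add]; exact add_mem hx hy

theorem d_Omega4_zero {θ : ℝ} {a : Omega7 θ} (ha : a ∈ A4 θ) : d θ a ∈ Omega4 θ 1 := by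
  rw [← one_mul (d θ a)]
  exact Submodule.mul_mem_mul (one_mem (A4 θ)) ⟨a, ha, rfl⟩

theorem d_Omega4 {θ : ℝ} {k : ℕ} {w : Omega7 θ} (hw : w ∈ Omega4 θ k) :
    d θ w ∈ Omega4 θ (k + 1) := by
  induction k generalizing w with
  | zero => exact d_Omega4_zero hw
  | succ k ih =>
    induction hw using Submodule.mul_induction_on' with
    | mem_mul_mem u hu x hx =>
      obtain ⟨b, hb, rfl⟩ := hx
      rw [(hasParity_Omega4 hu).d_mul, d_d, mul_zero, mul_zero, add_zero]
      exact Submodule.mul_mem_mul (ih hu) ⟨b, hb, rfl⟩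
    | add x _ y _ hx hy => rw [map_add]; exact add_mem hx hy

/-! ### Commutation phases of the z's and their differentials. -/

theorem mu_ne_zero (θ : ℝ) : mu θ ≠ 0 := Complex.exp_ne_zero _

theorem star_mu (θ : ℝ) : star (mu θ) = (mu θ)⁻¹ := by
  rw [mu, ← Complex.exp_neg, Complex.star_def, ← Complex.exp_conj]
  congr 1
  simp [Complex.conj_ofNat]

theorem lamPrime_eq (θ : ℝ) (a b : Fin 4) :
    lamPrime θ a b = !![1, 1, (mu θ)⁻¹, mu θ; 1, 1, mu θ, (mu θ)⁻¹;
      mu θ, (mu θ)⁻¹, 1, 1; (mu θ)⁻¹, mu θ, 1, 1] a b := by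
  rw [mu, ← Complex.exp_neg]
  fin_cases a <;> fin_cases b <;> simp [lamPrime, thetaPrime]

/-- The phases that `z_i` picks up when it is moved past the coordinates. -/
def twist (θ : ℝ) : Fin 5 → Fin 4 → ℂ :=
  ![![1, 1, 1, 1],
    ![mu θ, (mu θ)⁻¹, mu θ, (mu θ)⁻¹],
    ![mu θ, (mu θ)⁻¹, (mu θ)⁻¹, mu θ],
    ![(mu θ)⁻¹, mu θ, (mu θ)⁻¹, mu θ],
    ![(mu θ)⁻¹, mu θ, mu θ, (mu θ)⁻¹]]

/-- This identifies the phases from the commutation relations with the Cartan factors of the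
coproduct, which is what makes the twisted Leibniz rule compatible with the algebra. -/
theorem twist_eq (θ : ℝ) (i : Fin 5) :
    lamPow θ (-(r1 i) • H2 + r2 i • H1) = Matrix.diagonal (twist θ i) := by
  rw [lamPow]
  congr 1
  funext a
  fin_cases i <;> fin_cases a <;> simp [twist, mu, r1, r2, H1, H2, ← Complex.exp_neg] <;>
    ring_nf

/-- Elements with the commutation phases of `z_i`. -/
def HasTwist (θ : ℝ) (i : Fin 5) (w : Omega7 θ) : Prop :=
  (∀ a, psi θ a * w = twist θ i a • (w * psi θ a)) ∧
    ∀ a, w * psiStar θ a = twist θ i a • (psiStar θ a * w)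

theorem HasTwist.add {θ : ℝ} {i : Fin 5} {v w : Omega7 θ} (hv : HasTwist θ i v)
    (hw : HasTwist θ i w) : HasTwist θ i (v + w) :=
  ⟨fun a => by rw [mul_add, add_mul, hv.1, hw.1, smul_add],
    fun a => by rw [mul_add, add_mul, hv.2, hw.2, smul_add]⟩

theorem HasTwist.neg {θ : ℝ} {i : Fin 5} {w : Omega7 θ} (hw : HasTwist θ i w) :
    HasTwist θ i (-w) :=
  ⟨fun a => by rw [mul_neg, neg_mul, hw.1, smul_neg],
    fun a => by rw [mul_neg, neg_mul, hw.2, smul_neg]⟩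

theorem HasTwist.sub {θ : ℝ} {i : Fin 5} {v w : Omega7 θ} (hv : HasTwist θ i v)
    (hw : HasTwist θ i w) : HasTwist θ i (v - w) :=
  sub_eq_add_neg v w ▸ hv.add hw.neg

theorem HasTwist.two_mul {θ : ℝ} {i : Fin 5} {w : Omega7 θ} (hw : HasTwist θ i w) :
    HasTwist θ i (2 * w) :=
  _root_.two_mul w ▸ hw.add hw

/-- The phase of a quadratic monomial is the product of the phases of its factors. One of the
factors may be a differential: it is only moved past generators of degree 0, so no sign appears. -/
theorem hasTwist_gen_mul_gen {θ : ℝ} {i : Fin 5} {x y : Gen}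
    (h : ∀ a, coef θ ⟨a, false, false⟩ x * coef θ ⟨a, false, false⟩ y = twist θ i a ∧
      coef θ x ⟨a, true, false⟩ * coef θ y ⟨a, true, false⟩ = twist θ i a) :
    HasTwist θ i (gen θ x * gen θ y) := by
  constructor <;> intro a
  · rw [← (h a).1, psi, ← mul_assoc, gen_comm θ _ x, smul_mul_assoc, mul_assoc, gen_comm θ _ y,
      mul_smul_comm, smul_smul, mul_assoc]
  · rw [← (h a).2, psiStar, mul_assoc, gen_comm θ y _, mul_smul_comm, ← mul_assoc, gen_comm θ x,
      smul_mul_assoc, smul_smul, mul_assoc, mul_comm (coef θ y _)]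

theorem hasTwist_z (θ : ℝ) (i : Fin 5) : HasTwist θ i (z θ i) := by
  have hm := mu_ne_zero θ
  fin_cases i
  · refine .sub (.sub (.add ?_ ?_) ?_) ?_
    all_goals
      refine hasTwist_gen_mul_gen fun a => ?_
      fin_cases a <;> simp [twist, coef, lamPrime_eq, hm]
  · refine .two_mul (.add ?_ ?_)
    all_goals
      refine hasTwist_gen_mul_gen fun a => ?_
      fin_cases a <;> simp [twist, coef, lamPrime_eq]
  · refine .two_mul (.add (.neg ?_) ?_)
    all_goals
      refine hasTwist_gen_mul_gen fun a => ?_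
      fin_cases a <;> simp [twist, coef, lamPrime_eq]
  · refine .two_mul (.add ?_ ?_)
    all_goals
      refine hasTwist_gen_mul_gen fun a => ?_
      fin_cases a <;> simp [twist, coef, lamPrime_eq]
  · refine .two_mul (.add (.neg ?_) ?_)
    all_goals
      refine hasTwist_gen_mul_gen fun a => ?_
      fin_cases a <;> simp [twist, coef, lamPrime_eq]

theorem d_gen_mul_gen (θ : ℝ) (a b : Fin 4) (c e : Bool) :
    d θ (gen θ ⟨a, c, false⟩ * gen θ ⟨b, e, false⟩) =
      gen θ ⟨a, c, true⟩ * gen θ ⟨b, e, false⟩ + gen θ ⟨a, c, false⟩ * gen θ ⟨b, e, true⟩ := by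
  simp [d_mul, parity_gen, d_gen]

theorem d_two_mul (θ : ℝ) (w : Omega7 θ) : d θ (2 * w) = 2 * d θ w := by
  rw [two_mul, map_add, two_mul]

theorem hasTwist_dz (θ : ℝ) (i : Fin 5) : HasTwist θ i (d θ (z θ i)) := by
  have hm := mu_ne_zero θ
  fin_cases i <;> simp only [z, psi, psiStar, Fin.zero_eta, Fin.mk_one, Fin.reduceFinMk,
    Matrix.cons_val, map_sub, map_add, map_neg, d_two_mul, d_gen_mul_gen]
  · refine .sub (.sub (.add (.add ?_ ?_) (.add ?_ ?_)) (.add ?_ ?_)) (.add ?_ ?_)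
    all_goals
      refine hasTwist_gen_mul_gen fun a => ?_
      fin_cases a <;> simp [twist, coef, lamPrime_eq, hm]
  · refine .two_mul (.add (.add ?_ ?_) (.add ?_ ?_))
    all_goals
      refine hasTwist_gen_mul_gen fun a => ?_
      fin_cases a <;> simp [twist, coef, lamPrime_eq]
  · refine .two_mul (.add (.neg (.add ?_ ?_)) (.add ?_ ?_))
    all_goals
      refine hasTwist_gen_mul_gen fun a => ?_
      fin_cases a <;> simp [twist, coef, lamPrime_eq]
  · refine .two_mul (.add (.add ?_ ?_) (.add ?_ ?_))
    all_goals
      refine hasTwist_gen_mul_gen fun a => ?_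
      fin_cases a <;> simp [twist, coef, lamPrime_eq]
  · refine .two_mul (.add (.neg (.add ?_ ?_)) (.add ?_ ?_))
    all_goals
      refine hasTwist_gen_mul_gen fun a => ?_
      fin_cases a <;> simp [twist, coef, lamPrime_eq]

/-! ### The projection and the Dirac matrices. -/

theorem psi_mul_psiStar (θ : ℝ) (a b : Fin 4) :
    psi θ a * psiStar θ b = lamPrime θ b a • (psiStar θ b * psi θ a) := by
  simpa [coef, psi, psiStar] using gen_comm θ ⟨a, false, false⟩ ⟨b, true, false⟩

theorem psi_mul_psi (θ : ℝ) (a b : Fin 4) :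
    psi θ a * psi θ b = lamPrime θ a b • (psi θ b * psi θ a) := by
  simpa [coef, psi, psiStar] using gen_comm θ ⟨a, false, false⟩ ⟨b, false, false⟩

theorem psiStar_mul_psiStar (θ : ℝ) (a b : Fin 4) :
    psiStar θ a * psiStar θ b = lamPrime θ a b • (psiStar θ b * psiStar θ a) := by
  simpa [coef, psi, psiStar] using gen_comm θ ⟨a, true, false⟩ ⟨b, true, false⟩

theorem sphere (θ : ℝ) : psiStar θ 0 * psi θ 0 + psiStar θ 1 * psi θ 1 + psiStar θ 2 * psi θ 2 +
    psiStar θ 3 * psi θ 3 = 1 := by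
  simpa [Fin.sum_univ_four, psi, psiStar] using gen_sphere θ

/-- The diagonal entries are the spherical relation. Off the diagonal the terms cancel in pairs,
since coordinates 0, 1 commute with each other and so do coordinates 2, 3. -/
theorem PsiStar_mul_Psi (θ : ℝ) : PsiStar θ * Psi θ = 1 := by
  have h := sphere θ
  ext i j
  fin_cases i <;> fin_cases j <;>
    simp [PsiStar, Psi, Matrix.mul_apply, Fin.sum_univ_four, psi_mul_psiStar, lamPrime_eq]
  · exact h
  · rw [psiStar_mul_psiStar θ 1 0, psiStar_mul_psiStar θ 3 2]
    simp [lamPrime_eq]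
  · rw [psi_mul_psi θ 1 0, psi_mul_psi θ 3 2]
    simp [lamPrime_eq]
  · rw [← h]; abel

/-- Besides making `p_gamma` computable, this shows that `p` has entries in `A4`. -/
theorem p_eq (θ : ℝ) : p θ = (1 / 2 : ℂ) •
    !![1 + z θ 0, 0, z θ 1, -((mu θ)⁻¹ • z θ 4);
      0, 1 + z θ 0, z θ 2, mu θ • z θ 3;
      z θ 3, z θ 4, 1 - z θ 0, 0;
      -(mu θ • z θ 2), (mu θ)⁻¹ • z θ 1, 0, 1 - z θ 0] := by
  have hm := mu_ne_zero θ
  -- Replacing 1 by the spherical sum makes both sides quadratic in the coordinates.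
  rw [← sphere θ]
  ext i j
  fin_cases i <;> fin_cases j <;>
    simp [p, PsiStar, Psi, z, Matrix.mul_apply, psi_mul_psiStar, lamPrime_eq,
      two_mul, smul_add, smul_sub, smul_smul, hm] <;>
    module

theorem mul_const_apply {θ : ℝ} {l m n : Type} [Fintype m] (M : Matrix l m (Omega7 θ))
    (N : Matrix m n ℂ) (j : l) (k : n) : (M * const θ N) j k = ∑ a, N a k • M j a := by
  simp [Matrix.mul_apply, const, Algebra.smul_def, Algebra.commutes]

theorem const_mul_apply {θ : ℝ} {l m n : Type} [Fintype m] (N : Matrix l m ℂ)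
    (M : Matrix m n (Omega7 θ)) (j : l) (k : n) : (const θ N * M) j k = ∑ a, N j a • M a k := by
  simp [Matrix.mul_apply, const, Algebra.smul_def]

theorem gamma_eq (θ : ℝ) : gamma θ =
    ![!![1, 0, 0, 0; 0, 1, 0, 0; 0, 0, -1, 0; 0, 0, 0, -1],
      !![0, 0, 0, 0; 0, 0, 0, 2; 2 * mu θ, 0, 0, 0; 0, 0, 0, 0],
      !![0, 0, 0, -2; 0, 0, 0, 0; 0, 2 * (mu θ)⁻¹, 0, 0; 0, 0, 0, 0],
      !![0, 0, 2 * (mu θ)⁻¹, 0; 0, 0, 0, 0; 0, 0, 0, 0; 0, 2, 0, 0],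
      !![0, 0, 0, 0; 0, 0, 2 * mu θ, 0; 0, 0, 0, 0; -2, 0, 0, 0]] := by
  have hs := star_mu θ
  rw [Complex.star_def] at hs
  funext i
  ext j k
  fin_cases i <;> fin_cases j <;> fin_cases k <;>
    simp [gamma, gamma0, gamma1, gamma2, hs]

/-- The scalar `2 × 2` matrix with entry `w`. -/
def scalarMat (θ : ℝ) (w : Omega7 θ) : Matrix (Fin 2) (Fin 2) (Omega7 θ) :=
  Matrix.diagonal fun _ => w

set_option maxHeartbeats 1000000 in
-- Checked by normal ordering all monomials; the powers of μ in γ_i absorb the resulting phases.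
theorem PsiStar_mul_gamma_mul_Psi (θ : ℝ) (i : Fin 5) :
    PsiStar θ * const θ (gamma θ i) * Psi θ = scalarMat θ (z θ i) := by
  have hm := mu_ne_zero θ
  ext j k
  rw [Matrix.mul_apply]
  simp only [mul_const_apply, gamma_eq]
  fin_cases i <;> fin_cases j <;> fin_cases k <;>
    simp [scalarMat, PsiStar, Psi, z, Fin.sum_univ_four, psi_mul_psiStar, lamPrime_eq, two_mul, smul_smul,
      psi_mul_psi θ 1 0, psi_mul_psi θ 2 0, psi_mul_psi θ 3 0, psi_mul_psi θ 2 1, psi_mul_psi θ 3 1,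
      psi_mul_psi θ 3 2, psiStar_mul_psiStar θ 1 0, psiStar_mul_psiStar θ 2 0,
      psiStar_mul_psiStar θ 3 0, psiStar_mul_psiStar θ 2 1, psiStar_mul_psiStar θ 3 1,
      psiStar_mul_psiStar θ 3 2]
  all_goals match_scalars <;> first | ring1 | (field_simp; done) | (field_simp; ring1)

set_option maxHeartbeats 1000000 in
-- A deformed Clifford relation: 2p − 1 is linear in the z's, with the Dirac matrices up to phases
-- as coefficients, so its anticommutator with γ_i retains only z_i.
theorem p_gamma (θ : ℝ) (i : Fin 5) :
    p θ * const θ (gamma θ i) + const θ (gamma θ i) * p θ =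
      const θ (gamma θ i) +
        (Matrix.diagonal fun a => twist θ i a • z θ i : Matrix (Fin 4) (Fin 4) (Omega7 θ)) := by
  have hm := mu_ne_zero θ
  rw [p_eq]
  ext j k
  simp only [mul_const_apply, const_mul_apply, Matrix.add_apply, gamma_eq]
  fin_cases i <;> fin_cases j <;> fin_cases k <;>
    simp [const, twist, Fin.sum_univ_four, Algebra.algebraMap_eq_smul_one, smul_smul]
  all_goals match_scalars <;> first | ring1 | (field_simp; done) | (field_simp; ring1)

/-! ### Cartan factors and conjugation by σ. -/

theorem const_mul_const (θ : ℝ) {l m n : Type} [Fintype m] (M : Matrix l m ℂ) (N : Matrix m n ℂ) :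
    const θ M * const θ N = const θ (M * N) :=
  (Matrix.map_mul (f := algebraMap ℂ (Omega7 θ))).symm

theorem const_one (θ : ℝ) {m : Type} [DecidableEq m] : const θ (1 : Matrix m m ℂ) = 1 := by
  simp [const]

theorem const_mul_smul {θ : ℝ} {l m n : Type} [Fintype m] (N : Matrix l m ℂ) (w : Omega7 θ)
    (M : Matrix m n (Omega7 θ)) : const θ N * (w • M) = w • (const θ N * M) := by
  ext j k
  simp [const_mul_apply, Finset.mul_sum]

theorem lamPow_mul (θ : ℝ) (H K : Fin 4 → ℝ) :
    lamPow θ H * lamPow θ K = lamPow θ (H + K) := by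
  rw [lamPow, lamPow, lamPow, Matrix.diagonal_mul_diagonal]
  congr 1
  funext a
  rw [← Complex.exp_add]
  congr 1
  simp only [Pi.add_apply]
  push_cast
  ring

theorem lamPow_zero (θ : ℝ) : lamPow θ 0 = 1 := by
  simp [lamPow]

theorem lamPow_r1 (θ : ℝ) (i : Fin 5) : lamPow θ (-(r1 i) • H2) = Matrix.diagonal
    ((![![1, 1, 1, 1], ![mu θ, (mu θ)⁻¹, mu θ, (mu θ)⁻¹], ![1, 1, 1, 1],
      ![(mu θ)⁻¹, mu θ, (mu θ)⁻¹, mu θ], ![1, 1, 1, 1]] : Fin 5 → Fin 4 → ℂ) i) := by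
  rw [lamPow]
  congr 1
  funext a
  fin_cases i <;> fin_cases a <;> simp [mu, r1, H2, ← Complex.exp_neg] <;> ring_nf

theorem lamPow_r2 (θ : ℝ) (i : Fin 5) : lamPow θ (-(r2 i) • H1) = Matrix.diagonal
    ((![![1, 1, 1, 1], ![1, 1, 1, 1], ![(mu θ)⁻¹, mu θ, mu θ, (mu θ)⁻¹], ![1, 1, 1, 1],
      ![mu θ, (mu θ)⁻¹, (mu θ)⁻¹, mu θ]] : Fin 5 → Fin 4 → ℂ) i) := by
  rw [lamPow]
  congr 1
  funext a
  fin_cases i <;> fin_cases a <;> simp [mu, r2, H1, ← Complex.exp_neg] <;> ring_nf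

/-- σ is a signed permutation matrix that swaps 0 with 1 and 2 with 3. -/
theorem sigma_conj (N : Matrix (Fin 4) (Fin 4) ℂ) (a b : Fin 4) :
    (sigma * N * sigmaᵀ)ᵀ a b = (![-1, 1, -1, 1] : Fin 4 → ℂ) a * (![-1, 1, -1, 1] : Fin 4 → ℂ) b *
      N ((![1, 0, 3, 2] : Fin 4 → Fin 4) b) ((![1, 0, 3, 2] : Fin 4 → Fin 4) a) := by
  rw [Matrix.transpose_apply, Matrix.mul_apply, Fin.sum_univ_four]
  simp only [Matrix.mul_apply, Fin.sum_univ_four, Matrix.transpose_apply]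
  fin_cases a <;> fin_cases b <;> simp [sigma]

/-- The swap sends H_2 to −H_2, so conjugation by σ inverts this Cartan factor. -/
theorem sigma_lamPow (θ : ℝ) (i : Fin 5) :
    (sigma * lamPow θ (-(r1 i) • H2) * sigmaᵀ)ᵀ * lamPow θ (-(r1 i) • H2) = 1 := by
  have hm := mu_ne_zero θ
  rw [lamPow_r1]
  ext j k
  rw [Matrix.mul_diagonal, sigma_conj]
  fin_cases i <;> fin_cases j <;> fin_cases k <;> simp [hm]

set_option maxHeartbeats 400000 in
theorem sigma_gamma (θ : ℝ) (i : Fin 5) :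
    (sigma * (lamPow θ (-(r2 i) • H1) * gamma θ i) * sigmaᵀ)ᵀ * lamPow θ (-(r1 i) • H2) =
      gamma θ i := by
  have hm := mu_ne_zero θ
  rw [lamPow_r1, lamPow_r2, gamma_eq]
  ext j k
  rw [Matrix.mul_diagonal, sigma_conj, Matrix.diagonal_mul]
  fin_cases i <;> fin_cases j <;> fin_cases k <;> simp [hm, mul_comm]
  field_simp

/-- Complex constants are central, so they can act on Ψ^* from the right through a transpose; z_i
must stay on the left. -/
theorem actPsiStar_eq (θ : ℝ) (i : Fin 5) :
    actPsiStar θ i = (1 / 2 : ℂ) •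
      (-(z θ i • (PsiStar θ * const θ (sigma * lamPow θ (-(r1 i) • H2) * sigmaᵀ)ᵀ)) +
        PsiStar θ * const θ (sigma * (lamPow θ (-(r2 i) • H1) * gamma θ i) * sigmaᵀ)ᵀ) := by
  have h : GamTilde θ i = (1 / 2 : ℂ) •
      (-(z θ i • const θ (sigma * lamPow θ (-(r1 i) • H2) * sigmaᵀ)) +
        const θ (sigma * (lamPow θ (-(r2 i) • H1) * gamma θ i) * sigmaᵀ)) := by
    simp only [GamTilde, Gam, Matrix.mul_smul, Matrix.smul_mul, Matrix.mul_add, Matrix.add_mul,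
      Matrix.mul_neg, Matrix.neg_mul, const_mul_smul, const_mul_const]
  ext k a
  simp only [actPsiStar, Matrix.of_apply, h, Matrix.smul_apply, Matrix.add_apply, Matrix.neg_apply,
    mul_const_apply, smul_eq_mul, smul_mul_assoc, add_mul, neg_mul, mul_assoc, Finset.sum_add_distrib,
    Finset.sum_neg_distrib, ← Finset.smul_sum, ← Finset.mul_sum, Matrix.transpose_apply]
  simp only [const, Matrix.map_apply, Algebra.smul_def]

/-- The coproduct factor λ^{-r_1 H_2} undoes the conjugation by σ, leaving no Cartan factor. -/
theorem actPsiStar_mul (θ : ℝ) (i : Fin 5) :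
    actPsiStar θ i * const θ (lamPow θ (-(r1 i) • H2)) =
      (1 / 2 : ℂ) • (-(z θ i • PsiStar θ) + PsiStar θ * const θ (gamma θ i)) := by
  rw [actPsiStar_eq, Matrix.smul_mul, Matrix.add_mul, Matrix.neg_mul, Matrix.smul_mul,
    Matrix.mul_assoc (PsiStar θ), Matrix.mul_assoc (PsiStar θ), const_mul_const, const_mul_const, sigma_lamPow, sigma_gamma,
    const_one, Matrix.mul_one]

/-! ### The twisted variation of the gauge potential. -/

/-- The matrix `w λ^{-r_1 H_2 + r_2 H_1}`. -/
def twistMat (θ : ℝ) (i : Fin 5) (w : Omega7 θ) : Matrix (Fin 4) (Fin 4) (Omega7 θ) :=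
  w • const θ (Matrix.diagonal (twist θ i))

theorem twistMat_eq (θ : ℝ) (i : Fin 5) (w : Omega7 θ) :
    twistMat θ i w = Matrix.diagonal fun a => twist θ i a • w := by
  ext a b
  by_cases h : a = b
  · subst h
    simp [twistMat, const, Algebra.smul_def, Algebra.commutes]
  · simp [twistMat, const, h]

theorem PsiStar_mul_twistMat {θ : ℝ} {i : Fin 5} {w : Omega7 θ} (h : HasTwist θ i w) :
    PsiStar θ * twistMat θ i w = w • PsiStar θ := by
  have hm := mu_ne_zero θ
  rw [twistMat_eq]
  ext k a
  rw [Matrix.mul_diagonal, Matrix.smul_apply, smul_eq_mul, mul_smul_comm]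
  fin_cases i <;> fin_cases k <;> fin_cases a <;>
    simp [PsiStar, h.1, h.2] <;> simp [twist, smul_smul, hm]

theorem twistMat_mul_Psi {θ : ℝ} {i : Fin 5} {w : Omega7 θ} (h : HasTwist θ i w) :
    twistMat θ i w * Psi θ = Psi θ * scalarMat θ w := by
  have hm := mu_ne_zero θ
  rw [twistMat_eq]
  ext a k
  rw [scalarMat, Matrix.mul_diagonal, Matrix.diagonal_mul, smul_mul_assoc]
  fin_cases i <;> fin_cases k <;> fin_cases a <;>
    simp [Psi, h.1, h.2] <;> simp [twist, smul_smul, hm]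

/-- `d` on matrices of forms. -/
def dMat (θ : ℝ) {m n : Type} : Matrix m n (Omega7 θ) →ₗ[ℂ] Matrix m n (Omega7 θ) :=
  (d θ).mapMatrix

theorem dMat_apply {θ : ℝ} {m n : Type} (M : Matrix m n (Omega7 θ)) (j : m) (k : n) :
    dMat θ M j k = d θ (M j k) := rfl

theorem map_d {θ : ℝ} {m n : Type} (M : Matrix m n (Omega7 θ)) : M.map (d θ) = dMat θ M := rfl

theorem dMat_dMat {θ : ℝ} {m n : Type} (M : Matrix m n (Omega7 θ)) : dMat θ (dMat θ M) = 0 := by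
  ext j k
  simp [dMat_apply, d_d]

theorem dMat_mul {θ : ℝ} {l m n : Type} [Fintype m] {M : Matrix l m (Omega7 θ)}
    (h : ∀ j k, HasParity θ 0 (M j k)) (N : Matrix m n (Omega7 θ)) :
    dMat θ (M * N) = dMat θ M * N + M * dMat θ N := by
  ext j k
  simp [dMat_apply, Matrix.mul_apply, (h _ _).d_mul, Finset.sum_add_distrib]

theorem dMat_mul_of_odd {θ : ℝ} {l m n : Type} [Fintype m] {M : Matrix l m (Omega7 θ)}
    (h : ∀ j k, HasParity θ 1 (M j k)) (N : Matrix m n (Omega7 θ)) :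
    dMat θ (M * N) = dMat θ M * N - M * dMat θ N := by
  ext j k
  simp [dMat_apply, Matrix.mul_apply, (h _ _).d_mul, sub_eq_add_neg, Finset.sum_add_distrib]

theorem dMat_smul {θ : ℝ} {m n : Type} {w : Omega7 θ} (h : HasParity θ 0 w)
    (M : Matrix m n (Omega7 θ)) : dMat θ (w • M) = d θ w • M + w • dMat θ M := by
  ext j k
  simp [dMat_apply, h.d_mul]

theorem dMat_const_mul {θ : ℝ} {l m n : Type} [Fintype m] (N : Matrix l m ℂ)
    (M : Matrix m n (Omega7 θ)) : dMat θ (const θ N * M) = const θ N * dMat θ M := by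
  ext j k
  simp [dMat_apply, const_mul_apply]

theorem dMat_one (θ : ℝ) {m : Type} [DecidableEq m] :
    dMat θ (1 : Matrix m m (Omega7 θ)) = 0 := by
  ext j k
  by_cases h : j = k <;> simp [dMat_apply, h, d_one]

theorem hasParity_Psi (θ : ℝ) (a : Fin 4) (k : Fin 2) : HasParity θ 0 (Psi θ a k) := by
  fin_cases a <;> fin_cases k <;>
    simp [HasParity, Psi, psi, psiStar, parity_neg, parity_gen]

theorem hasParity_PsiStar (θ : ℝ) (k : Fin 2) (a : Fin 4) : HasParity θ 0 (PsiStar θ k a) := by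
  fin_cases a <;> fin_cases k <;>
    simp [HasParity, PsiStar, psi, psiStar, parity_neg, parity_gen]

/-- Each leg of the coproduct gives ½(Ψ^*γ_i dΨ − z_i Ψ^*dΨ). The second leg also differentiates the
z_i inside Γ_i, and Ψ^*Ψ = 1 reduces that term to the scalar −½ dz_i. -/
theorem deltaOmega_eq (θ : ℝ) (i : Fin 5) :
    deltaOmega θ i = PsiStar θ * const θ (gamma θ i) * dMat θ (Psi θ) -
      z θ i • (PsiStar θ * dMat θ (Psi θ)) -
      (1 / 2 : ℂ) • scalarMat θ (d θ (z θ i)) := by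
  have h2 : const θ (lamPow θ (r2 i • H1)) * dMat θ (actPsi θ i) = (1 / 2 : ℂ) •
      (-(twistMat θ i (d θ (z θ i)) * Psi θ + twistMat θ i (z θ i) * dMat θ (Psi θ)) +
        const θ (gamma θ i) * dMat θ (Psi θ)) := by
    -- The factor λ^{r_2 H_1} completes the λ^{-r_1 H_2} in Γ_i to the commutation phases, and in
    -- `hL'` it cancels the factor in front of γ_i.
    have hL : const θ (lamPow θ (r2 i • H1)) * const θ (lamPow θ (-(r1 i) • H2)) =
        const θ (Matrix.diagonal (twist θ i)) := by
      rw [const_mul_const, lamPow_mul, add_comm, twist_eq]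
    have hL' : const θ (lamPow θ (r2 i • H1)) * const θ (lamPow θ (-(r2 i) • H1) * gamma θ i) =
        const θ (gamma θ i) := by
      rw [const_mul_const, ← Matrix.mul_assoc, lamPow_mul, neg_smul, add_neg_cancel, lamPow_zero,
        Matrix.one_mul]
    rw [actPsi, Gam, Matrix.smul_mul, Matrix.add_mul, Matrix.neg_mul, Matrix.smul_mul, map_smul,
      map_add, map_neg, dMat_smul (hasParity_z θ i), dMat_const_mul, dMat_const_mul,
      Matrix.mul_smul, Matrix.mul_add, Matrix.mul_neg, Matrix.mul_add, const_mul_smul,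
      const_mul_smul, ← Matrix.mul_assoc, ← Matrix.mul_assoc, ← Matrix.mul_assoc, hL, hL',
      twistMat, twistMat, Matrix.smul_mul, Matrix.smul_mul]
  have h3 : d θ (z θ i) • (1 : Matrix (Fin 2) (Fin 2) (Omega7 θ)) =
      scalarMat θ (d θ (z θ i)) := by
    rw [scalarMat, ← Matrix.diagonal_one, ← Matrix.diagonal_smul]
    simp [Pi.smul_def]
  rw [deltaOmega, map_d, map_d, ← Matrix.mul_assoc, actPsiStar_mul, Matrix.mul_assoc, h2,
    Matrix.mul_smul, Matrix.mul_add, Matrix.mul_neg, Matrix.mul_add, ← Matrix.mul_assoc,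
    ← Matrix.mul_assoc, ← Matrix.mul_assoc, PsiStar_mul_twistMat (hasTwist_z θ i),
    PsiStar_mul_twistMat (hasTwist_dz θ i), Matrix.smul_mul (d θ (z θ i)), PsiStar_mul_Psi, h3]
  simp only [Matrix.smul_mul, Matrix.add_mul, Matrix.neg_mul]
  generalize z θ i • (PsiStar θ * dMat θ (Psi θ)) = X
  module

/-- The variation of the connection as a matrix-valued form. -/
def alpha (θ : ℝ) (i : Fin 5) : Matrix (Fin 4) (Fin 4) (Omega7 θ) :=
  p θ * const θ (gamma θ i) * dMat θ (p θ) * p θ - (1 / 2 : ℂ) • (twistMat θ i (d θ (z θ i)) * p θ)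

theorem p_mul_p (θ : ℝ) : p θ * p θ = p θ := by
  rw [p, Matrix.mul_assoc, ← Matrix.mul_assoc (PsiStar θ), PsiStar_mul_Psi, Matrix.one_mul]

theorem dMat_p (θ : ℝ) :
    dMat θ (p θ) = dMat θ (Psi θ) * PsiStar θ + Psi θ * dMat θ (PsiStar θ) :=
  dMat_mul (hasParity_Psi θ) _

theorem dPsiStar_mul_Psi (θ : ℝ) :
    dMat θ (PsiStar θ) * Psi θ = -(PsiStar θ * dMat θ (Psi θ)) := by
  have h := dMat_mul (hasParity_PsiStar θ) (Psi θ)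
  rw [PsiStar_mul_Psi, dMat_one] at h
  exact eq_neg_of_add_eq_zero_left h.symm

theorem smul_eq_scalarMat_mul {θ : ℝ} {n : Type} (w : Omega7 θ)
    (M : Matrix (Fin 2) n (Omega7 θ)) : w • M = scalarMat θ w * M := by
  ext j k
  rw [scalarMat, Matrix.diagonal_mul, Matrix.smul_apply, smul_eq_mul]

theorem p_mul_Psi (θ : ℝ) : p θ * Psi θ = Psi θ := by
  rw [p, Matrix.mul_assoc, PsiStar_mul_Psi, Matrix.mul_one]

theorem PsiStar_mul_p (θ : ℝ) : PsiStar θ * p θ = PsiStar θ := by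
  rw [p, ← Matrix.mul_assoc, PsiStar_mul_Psi, Matrix.one_mul]

theorem p_mul_twistMat {θ : ℝ} {i : Fin 5} {w : Omega7 θ} (h : HasTwist θ i w) :
    p θ * twistMat θ i w = twistMat θ i w * p θ := by
  rw [p, Matrix.mul_assoc, PsiStar_mul_twistMat h, ← Matrix.mul_assoc, twistMat_mul_Psi h,
    smul_eq_scalarMat_mul, Matrix.mul_assoc]

/-- Since dp p = dΨ Ψ^* − ΨΨ^*dΨ Ψ^* and pγ_i Ψ = uΨ with u = `twistMat θ i (z θ i)`, the product
pγ_i dp p gives both terms of δω_i that contain dΨ. -/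
theorem Psi_deltaOmega_PsiStar (θ : ℝ) (i : Fin 5) :
    Psi θ * deltaOmega θ i * PsiStar θ = alpha θ i := by
  have h1 : p θ * const θ (gamma θ i) * Psi θ = twistMat θ i (z θ i) * Psi θ := by
    rw [twistMat_mul_Psi (hasTwist_z θ i), ← PsiStar_mul_gamma_mul_Psi, p]
    simp only [Matrix.mul_assoc]
  have h2 : dMat θ (p θ) * p θ =
      dMat θ (Psi θ) * PsiStar θ - Psi θ * (PsiStar θ * dMat θ (Psi θ) * PsiStar θ) := by
    rw [dMat_p, Matrix.add_mul, Matrix.mul_assoc, PsiStar_mul_p, Matrix.mul_assoc (Psi θ), p,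
      ← Matrix.mul_assoc (dMat θ (PsiStar θ)), dPsiStar_mul_Psi, Matrix.neg_mul, Matrix.mul_neg,
      sub_eq_add_neg]
  rw [alpha, Matrix.mul_assoc (p θ * _), h2, Matrix.mul_sub, ← Matrix.mul_assoc _ (Psi θ), h1,
    twistMat_mul_Psi (hasTwist_z θ i), deltaOmega_eq, smul_eq_scalarMat_mul, Matrix.mul_sub,
    Matrix.mul_sub, Matrix.sub_mul, Matrix.sub_mul, Matrix.mul_smul, Matrix.smul_mul,
    ← twistMat_mul_Psi (hasTwist_dz θ i), p]
  simp only [Matrix.mul_assoc]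

/-! ### First variation of the curvature. -/

/-- The algebra behind the first variation of the curvature. -/
theorem variation_identity {R : Type*} [Ring R] [Algebra ℂ R] {p q g u w : R} (hp : p * p = p)
    (hq : q = q * p + p * q) (hg : p * g + g * p = g + u) (hu : p * u = u * p)
    (hqu : q * u = u * q) (hw : p * w = w * p) :
    p * (q * g * q * p - p * g * q * q + (1 / 2 : ℂ) • (w * q)) * p =
      -2 * (u * (p * q * q)) := by
  have hpqp : p * q * p = 0 := by
    have h : p * q = p * q * p + p * q := by
      conv_lhs => rw [hq]
      rw [mul_add, ← mul_assoc, ← mul_assoc, hp]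
    simpa using h
  have hpgp : p * g * p = u * p := by
    have h : p * g + p * g * p = p * g + p * u := by
      rw [← mul_add, ← hg, mul_add, ← mul_assoc, hp, mul_assoc]
    rw [← hu]
    exact add_left_cancel h
  -- q exchanges the ranges of p and 1 − p, hence q² commutes with p.
  have hpq : p * q = q * (1 - p) := by rw [mul_sub, mul_one]; nth_rw 2 [hq]; abel
  have hqp : q * p = (1 - p) * q := by rw [sub_mul, one_mul]; nth_rw 2 [hq]; abel
  have hqqp : q * q * p = p * q * q := by
    rw [mul_assoc, hqp, ← mul_assoc, ← hpq]
  have hgg : (1 - p) * g * (1 - p) = -(u * (1 - p)) := by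
    have : (1 - p) * g * (1 - p) = g - (p * g + g * p) + p * g * p := by noncomm_ring
    rw [this, hg, hpgp]
    noncomm_ring
  -- Pulling the outer p's through q leaves g compressed to 1 − p, where it acts as −u.
  have e1 : p * (q * g * q * p) * p = -(u * (p * q * q)) := by
    calc p * (q * g * q * p) * p = p * q * g * (q * (p * p)) := by noncomm_ring
      _ = q * ((1 - p) * g * (1 - p)) * q := by rw [hp, hpq, hqp]; noncomm_ring
      _ = -(u * (p * q * q)) := by 
        rw [hgg, hpq, mul_neg, neg_mul, ← mul_assoc q, hqu, mul_assoc u, mul_assoc u]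
  have e2 : p * (p * g * q * q) * p = u * (p * q * q) := by
    calc p * (p * g * q * q) * p = p * p * g * (q * q * p) := by noncomm_ring
      _ = p * g * p * q * q := by rw [hp, hqqp]; noncomm_ring
      _ = u * (p * q * q) := by rw [hpgp]; noncomm_ring
  -- w commutes with p, so the off-diagonal q is squeezed between two p's.
  have e3 : p * (w * q) * p = 0 := by
    rw [← mul_assoc, hw, mul_assoc, mul_assoc, ← mul_assoc p, hpqp, mul_zero]
  rw [mul_add, mul_sub, add_mul, sub_mul, e1, e2, mul_smul_comm, smul_mul_assoc, e3, smul_zero]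
  noncomm_ring

theorem dMat_twistMat (θ : ℝ) (i : Fin 5) (w : Omega7 θ) :
    dMat θ (twistMat θ i w) = twistMat θ i (d θ w) := by
  rw [twistMat_eq, twistMat_eq]
  ext a b
  by_cases h : a = b
  · subst h
    simp [dMat_apply]
  · simp [dMat_apply, h]

theorem hasParity_twistMat {θ : ℝ} {i : Fin 5} {k : ℕ} {w : Omega7 θ} (h : HasParity θ k w)
    (a b : Fin 4) : HasParity θ k (twistMat θ i w a b) := by
  rw [twistMat_eq, Matrix.diagonal_apply]
  split_ifs
  · exact h.smul _
  · simp [HasParity, parity]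

theorem hasParity_p (θ : ℝ) (a b : Fin 4) : HasParity θ 0 (p θ a b) := by
  rw [p, Matrix.mul_apply]
  exact HasParity.sum fun k _ => (hasParity_Psi θ a k).mul (hasParity_PsiStar θ k b)

theorem hasParity_dp (θ : ℝ) (a b : Fin 4) : HasParity θ 1 (dMat θ (p θ) a b) :=
  (hasParity_p θ a b).d

theorem dMat_alpha (θ : ℝ) (i : Fin 5) :
    dMat θ (alpha θ i) = dMat θ (p θ) * const θ (gamma θ i) * dMat θ (p θ) * p θ -
      p θ * const θ (gamma θ i) * dMat θ (p θ) * dMat θ (p θ) +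
      (1 / 2 : ℂ) • (twistMat θ i (d θ (z θ i)) * dMat θ (p θ)) := by
  have h1 : dMat θ (p θ * const θ (gamma θ i) * dMat θ (p θ) * p θ) =
      dMat θ (p θ) * const θ (gamma θ i) * dMat θ (p θ) * p θ -
        p θ * const θ (gamma θ i) * dMat θ (p θ) * dMat θ (p θ) := by
    simp only [Matrix.mul_assoc]
    rw [dMat_mul (hasParity_p θ), dMat_const_mul, dMat_mul_of_odd (hasParity_dp θ), dMat_dMat,
      Matrix.zero_mul, zero_sub, Matrix.mul_neg, Matrix.mul_neg, sub_eq_add_neg]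
  have h2 : dMat θ (twistMat θ i (d θ (z θ i)) * p θ) =
      -(twistMat θ i (d θ (z θ i)) * dMat θ (p θ)) := by
    rw [dMat_mul_of_odd (hasParity_twistMat (hasParity_z θ i).d), dMat_twistMat, d_d, twistMat,
      zero_smul, Matrix.zero_mul, zero_sub]
  rw [alpha, map_sub, map_smul, h1, h2, smul_neg, sub_neg_eq_add]

theorem dMat_p_eq (θ : ℝ) : dMat θ (p θ) = dMat θ (p θ) * p θ + p θ * dMat θ (p θ) := by
  rw [← dMat_mul (hasParity_p θ), p_mul_p]

/-- One formula covers all five cases: the exponents −H_2, H_1, H_2, −H_1 are −r_1 H_2 + r_2 H_1 at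
the respective weights. -/
theorem deltaF_eq (θ : ℝ) (i : Fin 5) :
    deltaF θ i = -2 * (twistMat θ i (z θ i) * F0 θ) := by
  have h : ∀ M : Matrix (Fin 4) (Fin 4) (Omega7 θ), -2 * M = (-2 : ℂ) • M := fun M => by
    rw [neg_mul, two_mul, neg_smul, two_smul]
  rw [h, twistMat, Matrix.smul_mul, ← twist_eq]
  fin_cases i <;> simp [deltaF, r1, r2, lamPow_zero, const_one]

/-- Differentiating pu = up suffices, because the terms with dz_i cancel: dz_i has the same phases
as z_i. -/
theorem dMat_p_mul_twistMat (θ : ℝ) (i : Fin 5) :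
    dMat θ (p θ) * twistMat θ i (z θ i) = twistMat θ i (z θ i) * dMat θ (p θ) := by
  have h := congrArg (dMat θ) (p_mul_twistMat (hasTwist_z θ i))
  rw [dMat_mul (hasParity_p θ), dMat_mul (hasParity_twistMat (hasParity_z θ i)), dMat_twistMat,
    p_mul_twistMat (hasTwist_dz θ i), add_comm] at h
  exact add_left_cancel h

theorem p_mul_dMat_alpha_mul_p (θ : ℝ) (i : Fin 5) :
    p θ * dMat θ (alpha θ i) * p θ = deltaF θ i := by
  rw [dMat_alpha, deltaF_eq, F0, map_d]
  refine variation_identity (p_mul_p θ) (dMat_p_eq θ) ?_ (p_mul_twistMat (hasTwist_z θ i))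
    (dMat_p_mul_twistMat θ i) (p_mul_twistMat (hasTwist_dz θ i))
  rw [twistMat_eq]
  exact p_gamma θ i

/-! ### Form valued endomorphisms and remainders of second order. -/

/-- Matrices of `k`-forms on the noncommutative 4-sphere. -/
def FormMat (θ : ℝ) (k : ℕ) : Submodule ℂ (Matrix (Fin 4) (Fin 4) (Omega7 θ)) where
  carrier := {M | ∀ a b, M a b ∈ Omega4 θ k}
  add_mem' hM hN a b := add_mem (hM a b) (hN a b)
  zero_mem' _ _ := zero_mem _
  smul_mem' c _ hM a b := Submodule.smul_mem _ c (hM a b)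

theorem FormMat.mul {θ : ℝ} {k l : ℕ} {M N : Matrix (Fin 4) (Fin 4) (Omega7 θ)}
    (hM : M ∈ FormMat θ k) (hN : N ∈ FormMat θ l) : M * N ∈ FormMat θ (k + l) := fun a b => by
  rw [Matrix.mul_apply]
  exact sum_mem fun c _ => Omega4_mul (hM a c) (hN c b)

theorem FormMat.d {θ : ℝ} {k : ℕ} {M : Matrix (Fin 4) (Fin 4) (Omega7 θ)}
    (hM : M ∈ FormMat θ k) : dMat θ M ∈ FormMat θ (k + 1) := fun a b => d_Omega4 (hM a b)

theorem const_mem_FormMat (θ : ℝ) (N : Matrix (Fin 4) (Fin 4) ℂ) : const θ N ∈ FormMat θ 0 :=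
  fun _ _ => algebraMap_mem (A4 θ) _

theorem z_mem_A4 (θ : ℝ) (i : Fin 5) : z θ i ∈ A4 θ :=
  Algebra.subset_adjoin (Set.mem_range_self i)

theorem twistMat_mem_FormMat {θ : ℝ} {i : Fin 5} {k : ℕ} {w : Omega7 θ} (h : w ∈ Omega4 θ k) :
    twistMat θ i w ∈ FormMat θ k := fun a b => by
  rw [twistMat_eq, Matrix.diagonal_apply]
  split_ifs
  · exact Submodule.smul_mem _ _ h
  · exact zero_mem _

theorem p_mem_FormMat (θ : ℝ) : p θ ∈ FormMat θ 0 := by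
  rw [p_eq]
  refine Submodule.smul_mem _ _ fun a b => ?_
  change _ ∈ A4 θ
  have h := z_mem_A4 θ
  have hs : ∀ (c : ℂ) i, c • z θ i ∈ A4 θ := fun c i => (A4 θ).smul_mem (h i) c
  fin_cases a <;> fin_cases b <;>
    simp [h, hs, add_mem, sub_mem, one_mem, zero_mem]

theorem EndForms.smul {θ : ℝ} {k : ℕ} {M : Matrix (Fin 4) (Fin 4) (Omega7 θ)}
    (hM : M ∈ EndForms θ k) (c : ℂ) : c • M ∈ EndForms θ k :=
  ⟨Submodule.smul_mem (FormMat θ k) c hM.1, by rw [Matrix.mul_smul, hM.2.1],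
    by rw [Matrix.smul_mul, hM.2.2]⟩

theorem EndForms.add {θ : ℝ} {k : ℕ} {M N : Matrix (Fin 4) (Fin 4) (Omega7 θ)}
    (hM : M ∈ EndForms θ k) (hN : N ∈ EndForms θ k) : M + N ∈ EndForms θ k :=
  ⟨add_mem (S := Submodule ℂ _) (s := FormMat θ k) hM.1 hN.1, by rw [mul_add, hM.2.1, hN.2.1],
    by rw [add_mul, hM.2.2, hN.2.2]⟩

theorem EndForms.sum {θ : ℝ} {k : ℕ} {ι : Type*} {s : Finset ι}
    {f : ι → Matrix (Fin 4) (Fin 4) (Omega7 θ)} (h : ∀ i ∈ s, f i ∈ EndForms θ k) :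
    ∑ i ∈ s, f i ∈ EndForms θ k :=
  ⟨Submodule.sum_mem (FormMat θ k) fun i hi => (h i hi).1,
    by rw [Finset.mul_sum]; exact Finset.sum_congr rfl fun i hi => (h i hi).2.1,
    by rw [Finset.sum_mul]; exact Finset.sum_congr rfl fun i hi => (h i hi).2.2⟩

theorem EndForms.mul {θ : ℝ} {k l : ℕ} {M N : Matrix (Fin 4) (Fin 4) (Omega7 θ)}
    (hM : M ∈ EndForms θ k) (hN : N ∈ EndForms θ l) : M * N ∈ EndForms θ (k + l) :=
  ⟨FormMat.mul hM.1 hN.1, by rw [← mul_assoc, hM.2.1], by rw [mul_assoc, hN.2.2]⟩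

theorem p_mul_mul_p_mem_EndForms {θ : ℝ} {k : ℕ} {M : Matrix (Fin 4) (Fin 4) (Omega7 θ)}
    (hM : M ∈ FormMat θ k) : p θ * M * p θ ∈ EndForms θ k := by
  refine ⟨?_, by rw [← mul_assoc, ← mul_assoc, p_mul_p], by rw [mul_assoc, p_mul_p]⟩
  have h := (FormMat.mul (FormMat.mul (p_mem_FormMat θ) hM) (p_mem_FormMat θ))
  rwa [zero_add, add_zero] at h

theorem alpha_mem_EndForms (θ : ℝ) (i : Fin 5) : alpha θ i ∈ EndForms θ 1 := by
  have h : alpha θ i = p θ * (const θ (gamma θ i) * dMat θ (p θ)) * p θ +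
      (-(1 / 2) : ℂ) • (p θ * twistMat θ i (d θ (z θ i)) * p θ) := by
    rw [alpha, p_mul_twistMat (hasTwist_dz θ i), mul_assoc (twistMat θ i _), p_mul_p, neg_smul,
      sub_eq_add_neg, mul_assoc (p θ) (const θ _)]
  rw [h]
  refine EndForms.add (p_mul_mul_p_mem_EndForms ?_) (EndForms.smul (p_mul_mul_p_mem_EndForms ?_) _)
  · simpa using FormMat.mul (const_mem_FormMat θ (gamma θ i)) (FormMat.d (p_mem_FormMat θ))
  · exact twistMat_mem_FormMat (d_Omega4_zero (z_mem_A4 θ i))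

theorem dp_mul_dp_mul_p (θ : ℝ) :
    dMat θ (p θ) * dMat θ (p θ) * p θ = p θ * dMat θ (p θ) * dMat θ (p θ) := by
  have hpq : p θ * dMat θ (p θ) = dMat θ (p θ) * (1 - p θ) := by
    rw [mul_sub, mul_one]
    exact eq_sub_of_add_eq ((add_comm _ _).trans (dMat_p_eq θ).symm)
  have hqp : dMat θ (p θ) * p θ = (1 - p θ) * dMat θ (p θ) := by
    rw [sub_mul, one_mul]
    exact eq_sub_of_add_eq (dMat_p_eq θ).symm
  rw [mul_assoc, hqp, ← mul_assoc, ← hpq]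

theorem F0_eq (θ : ℝ) : F0 θ = p θ * (dMat θ (p θ) * dMat θ (p θ)) * p θ := by
  rw [mul_assoc, dp_mul_dp_mul_p, F0, map_d, ← mul_assoc, ← mul_assoc, p_mul_p]

theorem F0_mem_EndForms (θ : ℝ) : F0 θ ∈ EndForms θ 2 := by
  rw [F0_eq]
  exact p_mul_mul_p_mem_EndForms
    (FormMat.mul (FormMat.d (p_mem_FormMat θ)) (FormMat.d (p_mem_FormMat θ)))

/-- As p dα p, the variation is visibly compressed on both sides. -/
theorem deltaF_mem_EndForms (θ : ℝ) (i : Fin 5) : deltaF θ i ∈ EndForms θ 2 := by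
  rw [← p_mul_dMat_alpha_mul_p]
  exact p_mul_mul_p_mem_EndForms (FormMat.d (alpha_mem_EndForms θ i).1)

theorem isOSq_of_fintype {θ : ℝ} {k : ℕ} {ι : Type*} [Fintype ι] (c : ι → ℝ → ℂ)
    (M : ι → Matrix (Fin 4) (Fin 4) (Omega7 θ)) (hc : ∀ j, c j =O[𝓝 0] fun t : ℝ => t ^ 2)
    (hM : ∀ j, M j ∈ EndForms θ k) : IsOSq θ k fun t => ∑ j, c j t • M j :=
  ⟨Fintype.card ι, fun j => c ((Fintype.equivFin ι).symm j),
    fun j => M ((Fintype.equivFin ι).symm j), fun _ => hc _, fun _ => hM _,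
    fun t => (Equiv.sum_comp (Fintype.equivFin ι).symm fun j => c j t • M j).symm⟩

theorem isOSq_smul {θ : ℝ} {k : ℕ} {c : ℝ → ℂ} {M : Matrix (Fin 4) (Fin 4) (Omega7 θ)}
    (hc : c =O[𝓝 0] fun t : ℝ => t ^ 2) (hM : M ∈ EndForms θ k) : IsOSq θ k fun t => c t • M := by
  simpa using isOSq_of_fintype (ι := Unit) (fun _ => c) (fun _ => M) (fun _ => hc) fun _ => hM

theorem IsOSq.add {θ : ℝ} {k : ℕ} {R S : ℝ → Matrix (Fin 4) (Fin 4) (Omega7 θ)}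
    (hR : IsOSq θ k R) (hS : IsOSq θ k S) : IsOSq θ k fun t => R t + S t := by
  obtain ⟨N, c, M, hc, hM, h⟩ := hR
  obtain ⟨N', c', M', hc', hM', h'⟩ := hS
  have := isOSq_of_fintype (θ := θ) (k := k) (Sum.elim c c') (Sum.elim M M')
    (by rintro (j | j); exacts [hc j, hc' j]) (by rintro (j | j); exacts [hM j, hM' j])
  simpa only [Fintype.sum_sum_type, Sum.elim_inl, Sum.elim_inr, ← h, ← h'] using this

/-- The scalars c_j(t) pass through d and through products, so the expansion has coefficients c_j,
t², t c_j and c_j c_l, all O(t²) because t and t² are bounded near 0. -/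
theorem isOSq_remainder {θ : ℝ} {B : ℝ → Matrix (Fin 4) (Fin 4) (Omega7 θ)}
    {α : Matrix (Fin 4) (Fin 4) (Omega7 θ)} (hB : IsOSq θ 1 B) (hα : α ∈ EndForms θ 1) :
    IsOSq θ 2 fun t => p θ * dMat θ (B t) * p θ +
      ((t : ℂ) • α + B t) * ((t : ℂ) • α + B t) := by
  obtain ⟨N, c, M, hc, hM, hB⟩ := hB
  have ht : (fun t : ℝ => (t : ℂ)) =O[𝓝 0] fun _ => (1 : ℝ) :=
    Complex.continuous_ofReal.continuousAt.isBigO_one ℝ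
  have ht2 : (fun t : ℝ => t ^ 2) =O[𝓝 0] fun _ => (1 : ℝ) :=
    (continuous_pow 2).continuousAt.isBigO_one ℝ
  have htt : (fun t : ℝ => (t : ℂ) * (t : ℂ)) =O[𝓝 0] fun t : ℝ => t ^ 2 :=
    Asymptotics.IsBigO.of_norm_le fun t => by simp [sq]
  have h1 : IsOSq θ 2 fun t => ∑ j, c j t • (p θ * dMat θ (M j) * p θ) :=
    isOSq_of_fintype _ _ hc fun j => p_mul_mul_p_mem_EndForms (FormMat.d (hM j).1)
  have h2 : IsOSq θ 2 fun t => ((t : ℂ) * (t : ℂ)) • (α * α) := isOSq_smul htt (EndForms.mul hα hα)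
  have h3 : IsOSq θ 2 fun t => ∑ j, ((t : ℂ) * c j t) • (α * M j + M j * α) :=
    isOSq_of_fintype (fun j t => (t : ℂ) * c j t) _
      (fun j => by simpa using ht.mul (hc j))
      fun j => EndForms.add (EndForms.mul hα (hM j)) (EndForms.mul (hM j) hα)
  -- The first index belongs to the right factor, which matches the nesting of the sums after
  -- expansion.
  have h4 : IsOSq θ 2 fun t => ∑ j : Fin N × Fin N, (c j.1 t * c j.2 t) • (M j.2 * M j.1) :=
    isOSq_of_fintype (fun (j : Fin N × Fin N) t => c j.1 t * c j.2 t) _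
      (fun j => by simpa using ((hc j.1).trans ht2).mul (hc j.2))
      fun j => EndForms.mul (hM j.2) (hM j.1)
  have h := ((h1.add h2).add h3).add h4
  convert h using 2 with t
  simp only [hB, map_sum, map_smul, Finset.mul_sum, Finset.sum_mul, Matrix.mul_smul,
    Matrix.smul_mul, add_mul, mul_add, Fintype.sum_prod_type, smul_add, smul_smul,
    Finset.sum_add_distrib]
  have hct : ∀ j, c j t * (t : ℂ) = t * c j t := fun j => mul_comm _ _
  simp only [hct]
  abel

/-! ### The connection on E and its square. -/

/-- `d` on vectors of forms. -/
def dVec (θ : ℝ) {m : Type} (η : m → Omega7 θ) : m → Omega7 θ := fun a => d θ (η a)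

theorem dVec_mulVec {θ : ℝ} {m n : Type} [Fintype n] {M : Matrix m n (Omega7 θ)}
    (h : ∀ j k, HasParity θ 0 (M j k)) (η : n → Omega7 θ) :
    dVec θ (M *ᵥ η) = dMat θ M *ᵥ η + M *ᵥ dVec θ η := by
  ext j
  simp [dVec, dMat_apply, Matrix.mulVec, dotProduct, (h _ _).d_mul, Finset.sum_add_distrib]

theorem dVec_mulVec_of_odd {θ : ℝ} {m n : Type} [Fintype n] {M : Matrix m n (Omega7 θ)}
    (h : ∀ j k, HasParity θ 1 (M j k)) (η : n → Omega7 θ) :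
    dVec θ (M *ᵥ η) = dMat θ M *ᵥ η - M *ᵥ dVec θ η := by
  ext j
  simp [dVec, dMat_apply, Matrix.mulVec, dotProduct, (h _ _).d_mul, Finset.sum_add_distrib,
    sub_eq_add_neg]

theorem dVec_add (θ : ℝ) {m : Type} (η ξ : m → Omega7 θ) :
    dVec θ (η + ξ) = dVec θ η + dVec θ ξ := by
  ext a; simp [dVec]

theorem dVec_smul (θ : ℝ) {m : Type} (c : ℂ) (η : m → Omega7 θ) :
    dVec θ (c • η) = c • dVec θ η := by
  ext a; simp [dVec]

theorem dVec_dVec (θ : ℝ) {m : Type} (η : m → Omega7 θ) : dVec θ (dVec θ η) = 0 := by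
  ext a; simp [dVec, d_d]

theorem p_dMat_p_p (θ : ℝ) : p θ * dMat θ (p θ) * p θ = 0 := by
  have h : p θ * dMat θ (p θ) = p θ * dMat θ (p θ) * p θ + p θ * dMat θ (p θ) := by
    conv_lhs => rw [dMat_p_eq]
    rw [mul_add, ← mul_assoc, ← mul_assoc, p_mul_p]
  simpa using h

/-- The terms without derivative of η at t = 0 add up to ΨdΨ^* + ΨωΨ^* = p dp, which kills η = pη
because p dp p = 0. -/
theorem conn_eq {θ : ℝ} (i : Fin 5) (B : ℝ → Matrix (Fin 4) (Fin 4) (Omega7 θ)) (t : ℝ)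
    {η : Fin 4 → Omega7 θ} (hη : p θ *ᵥ η = η) :
    conn θ i B t η = p θ *ᵥ dVec θ η + ((t : ℂ) • alpha θ i + B t) *ᵥ η := by
  have h1 : Psi θ * dMat θ (PsiStar θ) + Psi θ * omega θ * PsiStar θ = p θ * dMat θ (p θ) := by
    rw [dMat_p, Matrix.mul_add, ← Matrix.mul_assoc (p θ) (Psi θ), p_mul_Psi, omega, map_d, p,
      add_comm]
    simp only [Matrix.mul_assoc]
  have h2 : (p θ * dMat θ (p θ)) *ᵥ η = 0 := by
    conv_lhs => rw [← hη]
    rw [Matrix.mulVec_mulVec, p_dMat_p_p, Matrix.zero_mulVec]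
  have h3 : conn θ i B t η = (Psi θ * dMat θ (PsiStar θ) + Psi θ * omega θ * PsiStar θ) *ᵥ η +
      (p θ *ᵥ dVec θ η + ((t : ℂ) • (Psi θ * deltaOmega θ i * PsiStar θ) + B t) *ᵥ η) := by
    have h4 : (fun k => d θ ((PsiStar θ *ᵥ η) k)) =
        dMat θ (PsiStar θ) *ᵥ η + PsiStar θ *ᵥ dVec θ η := dVec_mulVec (hasParity_PsiStar θ) η
    rw [conn, connEquiv, h4, p]
    simp only [Matrix.mulVec_add, Matrix.add_mulVec, Matrix.mulVec_mulVec,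
      Matrix.add_mul, Matrix.mul_smul, Matrix.smul_mul, Matrix.mul_assoc]
    abel
  rw [h3, h1, h2, zero_add, Psi_deltaOmega_PsiStar]

theorem mulVec_mem_Omega4 {θ : ℝ} {k l : ℕ} {M : Matrix (Fin 4) (Fin 4) (Omega7 θ)}
    (hM : M ∈ FormMat θ k) {η : Fin 4 → Omega7 θ} (hη : ∀ a, η a ∈ Omega4 θ l) (a : Fin 4) :
    (M *ᵥ η) a ∈ Omega4 θ (k + l) := by
  rw [Matrix.mulVec, dotProduct]
  exact sum_mem fun b _ => Omega4_mul (hM a b) (hη b)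

theorem conn_mem_EForms {θ : ℝ} {i : Fin 5} {B : ℝ → Matrix (Fin 4) (Fin 4) (Omega7 θ)} {t : ℝ}
    (hB : B t ∈ EndForms θ 1) {k : ℕ} {η : Fin 4 → Omega7 θ} (hη : η ∈ EForms θ k) :
    conn θ i B t η ∈ EForms θ (k + 1) := by
  have hβ := EndForms.add (EndForms.smul (alpha_mem_EndForms θ i) (t : ℂ)) hB
  rw [conn_eq i B t hη.2]
  refine ⟨fun a => add_mem ?_ ?_, ?_⟩
  · have h := mulVec_mem_Omega4 (p_mem_FormMat θ) (fun b => d_Omega4 (hη.1 b)) a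
    rwa [zero_add] at h
  · have h := mulVec_mem_Omega4 hβ.1 hη.1 a
    rwa [add_comm 1 k] at h
  · rw [Matrix.mulVec_add, Matrix.mulVec_mulVec, Matrix.mulVec_mulVec, p_mul_p, hβ.2.1]

theorem conn_conn_eq {θ : ℝ} {i : Fin 5} {B : ℝ → Matrix (Fin 4) (Fin 4) (Omega7 θ)} {t : ℝ}
    (hB : B t ∈ EndForms θ 1) {k : ℕ} {η : Fin 4 → Omega7 θ} (hη : η ∈ EForms θ k) :
    conn θ i B t (conn θ i B t η) = (F0 θ + (t : ℂ) • deltaF θ i + (p θ * dMat θ (B t) * p θ +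
      ((t : ℂ) • alpha θ i + B t) * ((t : ℂ) • alpha θ i + B t))) *ᵥ η := by
  have hβ := EndForms.add (EndForms.smul (alpha_mem_EndForms θ i) (t : ℂ)) hB
  rw [conn_eq i B t (conn_mem_EForms hB hη).2, conn_eq i B t hη.2, ← p_mul_dMat_alpha_mul_p]
  have hd : (t : ℂ) • (p θ * dMat θ (alpha θ i) * p θ) + p θ * dMat θ (B t) * p θ =
      p θ * dMat θ ((t : ℂ) • alpha θ i + B t) * p θ := by
    rw [map_add, map_smul, mul_add, add_mul, Matrix.mul_smul, Matrix.smul_mul]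
  have hpar : ∀ a b, HasParity θ 1 (((t : ℂ) • alpha θ i + B t) a b) := fun a b =>
    hasParity_Omega4 (hβ.1 a b)
  rw [add_assoc (F0 θ), ← add_assoc ((t : ℂ) • _), hd]
  generalize (t : ℂ) • alpha θ i + B t = β at hβ hpar ⊢
  have h0 : dVec θ η = dMat θ (p θ) *ᵥ η + p θ *ᵥ dVec θ η := by
    conv_lhs => rw [← hη.2, dVec_mulVec (hasParity_p θ)]
  -- This is where F_0 arises: differentiating η = pη and using p dp p = 0 turns p dp dη into p dp
  -- dp η.
  have h1 : (p θ * dMat θ (p θ)) *ᵥ dVec θ η = F0 θ *ᵥ η := by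
    rw [h0, Matrix.mulVec_add, Matrix.mulVec_mulVec, Matrix.mulVec_mulVec, p_dMat_p_p,
      Matrix.zero_mulVec, add_zero, F0, map_d]
  have h2 : (p θ * dMat θ β * p θ) *ᵥ η = (p θ * dMat θ β) *ᵥ η := by
    rw [← Matrix.mulVec_mulVec, hη.2]
  -- β is odd, so p d(βη) contains −β dη; this cancels β(p dη) = β dη, and no derivative of η
  -- survives.
  rw [dVec_add, dVec_mulVec (hasParity_p θ), dVec_dVec, dVec_mulVec_of_odd hpar, Matrix.mulVec_zero,
    add_zero, Matrix.add_mulVec, Matrix.add_mulVec, h2, ← h1]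
  simp only [Matrix.mulVec_add, Matrix.mulVec_sub, Matrix.mulVec_mulVec, hβ.2.1, hβ.2.2]
  abel

theorem mulVec_mul_right {θ : ℝ} {m n : Type} [Fintype n] (M : Matrix m n (Omega7 θ))
    (η : n → Omega7 θ) (ρ : Omega7 θ) :
    (M *ᵥ fun a => η a * ρ) = fun a => (M *ᵥ η) a * ρ := by
  ext a
  simp [Matrix.mulVec, dotProduct, Finset.sum_mul, mul_assoc]

theorem isConnection_conn {θ : ℝ} (i : Fin 5) {B : ℝ → Matrix (Fin 4) (Fin 4) (Omega7 θ)} {t : ℝ}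
    (hB : B t ∈ EndForms θ 1) : IsConnection θ (conn θ i B t) where
  maps k η hη := conn_mem_EForms hB hη
  add k η hη ξ hξ := by
    have h : p θ *ᵥ (η + ξ) = η + ξ := by rw [Matrix.mulVec_add, hη.2, hξ.2]
    rw [conn_eq i B t hη.2, conn_eq i B t hξ.2, conn_eq i B t h, dVec_add, Matrix.mulVec_add,
      Matrix.mulVec_add]
    abel
  smul k η hη c := by
    have h : p θ *ᵥ (c • η) = c • η := by rw [Matrix.mulVec_smul, hη.2]
    rw [conn_eq i B t hη.2, conn_eq i B t h, dVec_smul, Matrix.mulVec_smul, Matrix.mulVec_smul,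
      smul_add]
  leibniz k l η hη ρ _ := by
    have h : (p θ *ᵥ fun a => η a * ρ) = fun a => η a * ρ := by rw [mulVec_mul_right, hη.2]
    have hd : dVec θ (fun a => η a * ρ) =
        (fun a => dVec θ η a * ρ) + fun a => η a * ((-1) ^ k * d θ ρ) := by
      ext a
      rw [dVec, (hasParity_Omega4 (hη.1 a)).d_mul, ← mul_assoc,
        ((Commute.neg_one_left (η a)).pow_left k).eq]
      simp only [Pi.add_apply, dVec, mul_assoc]
    rw [conn_eq i B t hη.2, conn_eq i B t h, hd, Matrix.mulVec_add, mulVec_mul_right,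
      mulVec_mul_right, mulVec_mul_right, hη.2]
    ext a
    simp only [Pi.add_apply, add_mul, ← mul_assoc, ((Commute.neg_one_left (η a)).pow_left k).eq]
    abel

theorem IsOSq.mem_EndForms {θ : ℝ} {k : ℕ} {R : ℝ → Matrix (Fin 4) (Fin 4) (Omega7 θ)}
    (hR : IsOSq θ k R) (t : ℝ) : R t ∈ EndForms θ k := by
  obtain ⟨N, c, M, -, hM, h⟩ := hR
  rw [h]
  exact EndForms.sum fun j _ => EndForms.smul (hM j) _

end ToricInstanton

end

theorem mainTheorem7 (θ : ℝ) (i : Fin 5)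
    (B : ℝ → Matrix (Fin 4) (Fin 4) (ToricInstanton.Omega7 θ))
    (hB : ToricInstanton.IsOSq θ 1 B) :
    (∀ t : ℝ, ToricInstanton.IsConnection θ (ToricInstanton.conn θ i B t)) ∧
    ToricInstanton.F0 θ ∈ ToricInstanton.EndForms θ 2 ∧
    ToricInstanton.deltaF θ i ∈ ToricInstanton.EndForms θ 2 ∧
    ∃ R : ℝ → Matrix (Fin 4) (Fin 4) (ToricInstanton.Omega7 θ),
      ToricInstanton.IsOSq θ 2 R ∧
      ∀ t : ℝ, ∀ k : ℕ, ∀ η ∈ ToricInstanton.EForms θ k,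
        ToricInstanton.conn θ i B t (ToricInstanton.conn θ i B t η) =
          (ToricInstanton.F0 θ + (t : ℂ) • ToricInstanton.deltaF θ i + R t) *ᵥ η :=
  ⟨fun t => ToricInstanton.isConnection_conn i (hB.mem_EndForms t),
    ToricInstanton.F0_mem_EndForms θ, ToricInstanton.deltaF_mem_EndForms θ i, _,
    ToricInstanton.isOSq_remainder hB (ToricInstanton.alpha_mem_EndForms θ i),
    fun t _ _ hη => ToricInstanton.conn_conn_eq (hB.mem_EndForms t) hη⟩
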